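/- Let $\mathbb{L}^5$ be $\mathbb{R}^5$ with the inner product $\langle u,v\rangle=-u_1v_1+u_2v_2+u_3v_3+u_4v_4+u_5v_5$, and let $\mathbb{H}^3\times\mathbb{R}=\{p\in\mathbb{L}^5: -p_1^2+p_2^2+p_3^2+p_4^2=-1,\ p_1>0\}$. Let $x:M\to\mathbb{H}^3\times\mathbb{R}$ be a smooth immersion of a smooth 3-manifold, with smooth unit normal field $N$ in $\mathbb{H}^3\times\mathbb{R}$ and shape operator $S$ (so $\widetilde\nabla_XN=-SX$, where $\widetilde\nabla$ is the Levi-Civita connection of $\mathbb{H}^3\times\mathbb{R}$). Let $T$ be the tangent vector field on $M$ determined by $\partial/\partial x_5=dx(T)+\sigma N$, and assume that $T$ vanishes nowhere. Assume that $M$ has principal curvatures $k_1,k_2,k_3:M\to\mathbb{R}$ that are pairwise distinct at every point, that $ST=k_1T$ (that is, $M$ is of class $\mathcal{A}$), and that $k_2=f_1(k_1)$ and $k_3=f_2(k_1)$ on $M$ for some functions $f_1,f_2$. Then $M$ is locally an open part of a hypersurface of the form $$X_{\alpha_1,\alpha_2}(s,v,w)=\bigl(\cosh\alpha_1(s)\cosh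 v,\ \cosh\alpha_1(s)\sinh v,\ \sinh\alpha_1(s)\cos w,\ \sinh\alpha_1(s)\sin w,\ \alpha_2(s)\bigr),$$ up to a linear isometry which is the same on each connected component. Precisely: for every connected component $M_0$ of $M$ there is a linear isometry $\Phi$ of $\mathbb{L}^5$ with $\Phi(\mathbb{H}^3\times\mathbb{R})=\mathbb{H}^3\times\mathbb{R}$ such that every $p\in M_0$ has an open neighbourhood $\mathcal{O}_p$ in $M$ with smooth coordinates $(s,v,w)$, and there are smooth functions $\alpha_1,\alpha_2$ on an open interval $J$ containing $s(\mathcal{O}_p)$, with $\alpha_1'^2+\alpha_2'^2=1$ and $\sinh\alpha_1>0$ on $J$, such that $x=\Phi\circ X_{\alpha_1,\alpha_2}(s,v,w)$ on $\mathcal{O}_p$. -/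

import Mathlib

open scoped Manifold ContDiff

/-- The Minkowski inner product of signature `(-,+,+,+,+)` on `ℝ⁵`. -/
def lorentz (u v : Fin 5 → ℝ) : ℝ :=
  -(u 0 * v 0) + u 1 * v 1 + u 2 * v 2 + u 3 * v 3 + u 4 * v 4

/-- `ℍ³ × ℝ` as a hypersurface of five-dimensional Minkowski space. -/
def H3R : Set (Fin 5 → ℝ) :=
  {p | -(p 0) ^ 2 + (p 1) ^ 2 + (p 2) ^ 2 + (p 3) ^ 2 = -1 ∧ 0 < p 0}

/-- The normal vector of `ℍ³ × ℝ` in Minkowski space at `p`; it satisfies `⟨ν, ν⟩ = -1`. -/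
def normalH3R (p : Fin 5 → ℝ) : Fin 5 → ℝ := ![p 0, p 1, p 2, p 3, 0]

/-- The coordinate vector field along the factor `ℝ`. -/
def verticalField : Fin 5 → ℝ := ![0, 0, 0, 0, 1]

/-- The orthogonal projection of Minkowski space onto the tangent space of `ℍ³ × ℝ` at `p`. -/
def projH3R (p u : Fin 5 → ℝ) : Fin 5 → ℝ := u + lorentz u (normalH3R p) • normalH3R p

section Hypersurface

variable {M : Type*} [TopologicalSpace M] [ChartedSpace (EuclideanSpace ℝ (Fin 3)) M]

/-- The differential at `q` of a map from a 3-manifold to `ℝ⁵`. -/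
noncomputable def differential (y : M → Fin 5 → ℝ) (q : M) :
    TangentSpace (𝓡 3) q →L[ℝ] (Fin 5 → ℝ) :=
  mfderiv (𝓡 3) 𝓘(ℝ, Fin 5 → ℝ) y q

/-- `x` is a smooth immersion of the 3-manifold `M` into `ℍ³ × ℝ`, and `N` is a smooth unit
normal vector field along it (tangent to `ℍ³ × ℝ`, orthogonal to `M`). -/
structure IsOrientedHypersurface (x N : M → Fin 5 → ℝ) : Prop where
  smooth_immersion : ContMDiff (𝓡 3) 𝓘(ℝ, Fin 5 → ℝ) ∞ x
  mem : ∀ q, x q ∈ H3R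
  injective_differential : ∀ q, Function.Injective (differential x q)
  smooth_normal : ContMDiff (𝓡 3) 𝓘(ℝ, Fin 5 → ℝ) ∞ N
  normal_unit : ∀ q, lorentz (N q) (N q) = 1
  normal_tangent : ∀ q, lorentz (N q) (normalH3R (x q)) = 0
  normal_orthogonal : ∀ q (X : TangentSpace (𝓡 3) q), lorentz (N q) (differential x q X) = 0

/-- The Levi-Civita derivative in `ℍ³ × ℝ` of the field `Z` along `x` in the direction `X`:
the tangential part of its flat derivative. -/
noncomputable def covDerivAlong (x Z : M → Fin 5 → ℝ) (q : M) (X : TangentSpace (𝓡 3) q) :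
    Fin 5 → ℝ :=
  projH3R (x q) (differential Z q X)

/-- `S` is the shape operator of the hypersurface `x` with respect to `N` (Weingarten formula);
it is determined by `x` and `N` because the differential of `x` is injective. -/
def IsShapeOperator (x N : M → Fin 5 → ℝ)
    (S : ∀ q : M, Module.End ℝ (TangentSpace (𝓡 3) q)) : Prop :=
  ∀ q (X : TangentSpace (𝓡 3) q), covDerivAlong x N q X = -differential x q (S q X)

/-- `T` is the component of the vertical field tangent to the hypersurface:
the vertical field is `T + σ N` along `x`. -/
def IsVerticalTangentPart (x N : M → Fin 5 → ℝ) (T : ∀ q : M, TangentSpace (𝓡 3) q) : Prop :=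
  ∃ σ : M → ℝ, ∀ q, verticalField = differential x q (T q) + σ q • N q

end Hypersurface

/-- `α₁, α₂` are smooth functions on the open interval `J` with `α₁'² + α₂'² = 1` and
`sinh α₁ > 0`. -/
structure IsProfile (J : Set ℝ) (α₁ α₂ : ℝ → ℝ) : Prop where
  isOpen : IsOpen J
  ordConnected : J.OrdConnected
  smooth₁ : ContDiffOn ℝ ∞ α₁ J
  smooth₂ : ContDiffOn ℝ ∞ α₂ J
  unit_speed : ∀ s ∈ J, deriv α₁ s ^ 2 + deriv α₂ s ^ 2 = 1
  sinh_pos : ∀ s ∈ J, 0 < Real.sinh (α₁ s)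

/-- The model hypersurface of `ℍ³ × ℝ` with profile `(α₁, α₂)`. -/
noncomputable def modelHypersurface (α₁ α₂ : ℝ → ℝ) (s v w : ℝ) : Fin 5 → ℝ :=
  ![Real.cosh (α₁ s) * Real.cosh v, Real.cosh (α₁ s) * Real.sinh v,
    Real.sinh (α₁ s) * Real.cos w, Real.sinh (α₁ s) * Real.sin w, α₂ s]

/-- A linear isometry of five-dimensional Minkowski space that maps `ℍ³ × ℝ` onto itself. -/
structure IsLinearIsometryH3R (Φ : (Fin 5 → ℝ) ≃ₗ[ℝ] (Fin 5 → ℝ)) : Prop where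
  isometry : ∀ u v, lorentz (Φ u) (Φ v) = lorentz u v
  image_eq : Φ '' H3R = H3R

/-- Near `p`, the map `x` is, up to `Φ`, an open part of a model hypersurface:
there are smooth coordinates `(s, v, w)` of the manifold around `p` in which
`x = Φ (modelHypersurface α₁ α₂ s v w)`. -/
def IsOpenPartOfModelNear {M : Type*} [TopologicalSpace M]
    [ChartedSpace (EuclideanSpace ℝ (Fin 3)) M] (x : M → Fin 5 → ℝ)
    (Φ : (Fin 5 → ℝ) ≃ₗ[ℝ] (Fin 5 → ℝ)) (p : M) : Prop :=
  ∃ (J : Set ℝ) (α₁ α₂ : ℝ → ℝ), IsProfile J α₁ α₂ ∧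
    ∃ c ∈ IsManifold.maximalAtlas (𝓡 3) ∞ M, p ∈ c.source ∧
      ∀ q ∈ c.source, c q 0 ∈ J ∧
        x q = Φ (modelHypersurface α₁ α₂ (c q 0) (c q 1) (c q 2))

open Set Filter Topology

/-! Let h be the height (coordinate 4 of x), σ the coordinate 4 of N, and y, n the horizontal parts
of x, N. Because T is principal, dσ = -k₁ dh; because T ≠ 0, h is a submersion. So locally σ = s(h)
and k₁ = -s'(h), and the assumed relations make k₂, k₃ functions of h too. The slices h = const are
surfaces in ℍ³ with unit normal η = n/√(1-σ²) and distinct principal curvatures kᵢ/√(1-σ²), i = 2,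
3, locally constant on each slice. Along T the pair (y, η) undergoes a hyperbolic rotation in its
own plane, so nearby slices are parallel surfaces.

The core is Cartan's classification of surfaces in ℍ³ with position g, unit normal ξ and distinct
constant principal curvatures l₂, l₃. The maps F = ξ + l₂ g and G = ξ + l₃ g each have rank one,
hence are curves with independent parameters, and ⟨F, G⟩ = 1 - l₂ l₃ is constant. Differentiating in
both parameters and counting dimensions (`lorentz_eq_zero_of_const_product`) gives l₂ l₃ = 1 and
puts F and G in orthogonal planes. If l₃² > 1, then G is timelike and its plane cuts ℍ³ in a
geodesic, the axis (`exists_axis_of_const_principal_curvatures`).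

Let P be the orthogonal projection onto that plane. From PF = 0 and PG = G it follows that Py = a(h)
y + b(h) η, also on the neighbouring parallel slices (`exists_axis_splitting`). Hence -⟨Py, y⟩ =
a(h): the distance to the axis depends on the height alone, which is what characterizes the models
(`exists_model_coordinates`).

For one isometry per component, P is recovered at each point from first-order data of the
hypersurface (`IsLocalHypersurface.axisProj_unique`). The local projections are therefore locally
constant, hence constant on components. The isometries themselves need not agree, but only P enters
the equation of the model. -/

/-! ### Smooth inverse function theorem. -/

theorem ContDiffOn.differentiableAt_of_isOpen {E G : Type*} [NormedAddCommGroup E]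
    [NormedSpace ℝ E] [NormedAddCommGroup G] [NormedSpace ℝ G] {f : E → G} {U : Set E} (hf : ContDiffOn ℝ ∞ f U)
    (hU : IsOpen U) {p : E} (hp : p ∈ U) : DifferentiableAt ℝ f p :=
  (hf.contDiffAt (hU.mem_nhds hp)).differentiableAt (by simp)

/-- The smooth inverse function theorem, with smoothness on open sets. -/
theorem exists_openPartialHomeomorph_of_bijective_fderiv {E F : Type*}
    [NormedAddCommGroup E] [NormedSpace ℝ E] [FiniteDimensional ℝ E] [NormedAddCommGroup F]
    [NormedSpace ℝ F] {f : E → F} {U : Set E} (hU : IsOpen U) (hf : ContDiffOn ℝ ∞ f U) {p : E} (hp : p ∈ U) (hb : Function.Bijective (fderiv ℝ f p)) :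
    ∃ e : OpenPartialHomeomorph E F, (∀ u, e u = f u) ∧ p ∈ e.source ∧ e.source ⊆ U ∧
      (∀ u ∈ e.source, Function.Bijective (fderiv ℝ f u)) ∧
      ContDiffOn ℝ ∞ e e.source ∧ ContDiffOn ℝ ∞ e.symm e.target := by
  have : CompleteSpace E := FiniteDimensional.complete ℝ E
  have hfp := hf.contDiffAt (hU.mem_nhds hp)
  let L : E ≃L[ℝ] F := (LinearEquiv.ofBijective (fderiv ℝ f p).toLinearMap hb).toContinuousLinearEquiv
  have hL : (L : E →L[ℝ] F) = fderiv ℝ f p := by ext v; rfl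
  have hs : HasStrictFDerivAt f (L : E →L[ℝ] F) p := by
    rw [hL]; exact hfp.hasStrictFDerivAt (by simp)
  let e₀ := hs.toOpenPartialHomeomorph f
  have hc : ContinuousOn (fderiv ℝ f) U := hf.continuousOn_fderiv_of_isOpen hU (by simp)
  -- Invertible operators form an open set. Restricting to V makes the inverse smooth on the whole
  -- target, not only at the image of p.
  let V : Set E := U ∩ fderiv ℝ f ⁻¹' range ((↑) : (E ≃L[ℝ] F) → E →L[ℝ] F)
  have hV : IsOpen V := hc.isOpen_inter_preimage hU ContinuousLinearEquiv.isOpen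
  have hpV : p ∈ V := ⟨hp, L, hL⟩
  refine ⟨e₀.restrOpen V hV, fun u => rfl, ⟨hs.mem_toOpenPartialHomeomorph_source, hpV⟩,
    fun u hu => hu.2.1, fun u hu => ?_, fun u hu => ?_, fun z hz => ?_⟩
  · obtain ⟨L', hL'⟩ := hu.2.2
    rw [← hL']
    exact L'.bijective
  · exact (hf.contDiffAt (hU.mem_nhds hu.2.1)).contDiffWithinAt
  · have hz' := (e₀.restrOpen V hV).map_target hz
    obtain ⟨L', hL'⟩ := hz'.2.2
    have hfa := hf.contDiffAt (hU.mem_nhds hz'.2.1)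
    refine ContDiffAt.contDiffWithinAt
      ((e₀.restrOpen V hV).contDiffAt_symm (f₀' := L') hz ?_ hfa)
    rw [hL']
    exact (hfa.differentiableAt (by simp)).hasFDerivAt

/-! ### Factoring through a submersion. -/

section LocalStructure

variable {E F G : Type*} [NormedAddCommGroup E] [NormedSpace ℝ E] [FiniteDimensional ℝ E]
  [NormedAddCommGroup F] [NormedSpace ℝ F] [FiniteDimensional ℝ F]
  [NormedAddCommGroup G] [NormedSpace ℝ G]

/-- A smooth map whose differential vanishes on the kernel of that of a submersion factors locally
through the submersion. -/
theorem exists_factor_through_submersion {ψ : E → F} {f : E → G} {U : Set E} (hU : IsOpen U)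
    (hψ : ContDiffOn ℝ ∞ ψ U) (hf : ContDiffOn ℝ ∞ f U) {p : E} (hp : p ∈ U)
    (hs : Function.Surjective (fderiv ℝ ψ p))
    (hker : ∀ u ∈ U, ∀ X, fderiv ℝ ψ u X = 0 → fderiv ℝ f u X = 0) :
    ∃ (V : Set F) (W : Set E) (g : F → G), IsOpen V ∧ IsOpen W ∧ p ∈ W ∧ W ⊆ U ∧
      ContDiffOn ℝ ∞ g V ∧ ∀ u ∈ W, ψ u ∈ V ∧ f u = g (ψ u) := by
  let K := LinearMap.ker (fderiv ℝ ψ p).toLinearMap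
  obtain ⟨π₀, hπ₀⟩ := K.subtype.exists_leftInverse_of_injective (by simp)
  let π : E →L[ℝ] K := LinearMap.toContinuousLinearMap π₀
  have hπ : ∀ k : K, π k = k := fun k => LinearMap.congr_fun hπ₀ k
  -- Completing ψ by a projection onto the kernel of its differential at p gives local coordinates
  -- in which f has zero derivative along K.
  let Ψ : E → F × K := fun u => (ψ u, π u)
  have hΨ : ContDiffOn ℝ ∞ Ψ U := hψ.prodMk π.contDiff.contDiffOn
  have hdψ : ∀ u ∈ U, HasFDerivAt ψ (fderiv ℝ ψ u) u := fun u hu =>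
    (hψ.differentiableAt_of_isOpen hU hu).hasFDerivAt
  have hdΨ : ∀ u ∈ U, HasFDerivAt Ψ ((fderiv ℝ ψ u).prod π) u := fun u hu =>
    (hdψ u hu).prodMk π.hasFDerivAt
  have hb : Function.Bijective (fderiv ℝ Ψ p) := by
    rw [(hdΨ p hp).fderiv]
    have hi : Function.Injective ((fderiv ℝ ψ p).prod π).toLinearMap := by
      rw [← LinearMap.ker_eq_bot, LinearMap.ker_eq_bot']
      intro X hX
      have h1 : fderiv ℝ ψ p X = 0 := congrArg Prod.fst hX
      have h2 : π X = 0 := congrArg Prod.snd hX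
      have h3 := hπ ⟨X, h1⟩
      simp only [h2] at h3
      exact (congrArg Subtype.val h3).symm
    have hd : Module.finrank ℝ E = Module.finrank ℝ (F × K) := by
      have h1 := LinearMap.finrank_range_add_finrank_ker (fderiv ℝ ψ p).toLinearMap
      rw [LinearMap.range_eq_top.2 hs, finrank_top] at h1
      rw [Module.finrank_prod, h1]
    exact ⟨hi, (LinearMap.injective_iff_surjective_of_finrank_eq_finrank hd).1 hi⟩
  obtain ⟨e, he, hpe, heU, -, -, hes⟩ := exists_openPartialHomeomorph_of_bijective_fderiv hU hΨ hp hb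
  have hpt : (ψ p, π p) ∈ e.target := by
    have := e.map_source hpe
    rwa [he] at this
  obtain ⟨ε, hε, hball⟩ := Metric.isOpen_iff.1 e.open_target _ hpt
  -- A product neighbourhood has convex fibres over V, so a vanishing derivative along K makes f
  -- constant on each fibre.
  rw [← ball_prod_same] at hball
  let V := Metric.ball (ψ p) ε
  let W := e.source ∩ e ⁻¹' (V ×ˢ Metric.ball (π p) ε)
  have hW : IsOpen W := e.isOpen_inter_preimage (Metric.isOpen_ball.prod Metric.isOpen_ball)
  have hsm : ContDiffOn ℝ ∞ (f ∘ e.symm) e.target :=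
    hf.comp hes fun z hz => heU (e.map_target hz)
  refine ⟨V, W, fun z => (f ∘ e.symm) (z, π p), Metric.isOpen_ball, hW, ⟨hpe, ?_⟩,
    fun u hu => heU hu.1, ?_, fun u hu => ?_⟩
  · rw [mem_preimage, he]
    exact ⟨Metric.mem_ball_self hε, Metric.mem_ball_self hε⟩
  · exact hsm.comp (contDiff_id.prodMk contDiff_const).contDiffOn
      fun z hz => hball ⟨hz, Metric.mem_ball_self hε⟩
  · have hu2 := hu.2
    rw [mem_preimage, he] at hu2
    refine ⟨hu2.1, ?_⟩
    have hfu : f u = (f ∘ e.symm) (ψ u, π u) := by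
      have : e.symm (Ψ u) = u := by rw [← he, e.left_inv hu.1]
      change f u = f (e.symm (Ψ u))
      rw [this]
    rw [hfu]
    have hd : ∀ k ∈ Metric.ball (π p) ε,
        HasFDerivAt (fun k => (f ∘ e.symm) (ψ u, k)) (0 : K →L[ℝ] G) k := by
      intro k hk
      have hz : (ψ u, k) ∈ e.target := hball ⟨hu2.1, hk⟩
      set v := e.symm (ψ u, k) with hv
      have hvU : v ∈ U := heU (e.map_target hz)
      have h1 : HasFDerivAt e.symm (fderiv ℝ e.symm (ψ u, k)) (ψ u, k) :=
        (hes.differentiableAt_of_isOpen e.open_target hz).hasFDerivAt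
      have h2 : HasFDerivAt f (fderiv ℝ f v) v := (hf.differentiableAt_of_isOpen hU hvU).hasFDerivAt
      have h3 : HasFDerivAt (fun z => ψ (e.symm z))
          ((fderiv ℝ ψ v).comp (fderiv ℝ e.symm (ψ u, k))) (ψ u, k) := (hdψ v hvU).comp _ h1
      have h4 : HasFDerivAt (fun z => ψ (e.symm z)) (ContinuousLinearMap.fst ℝ F K) (ψ u, k) := by
        refine (hasFDerivAt_fst).congr_of_eventuallyEq ?_
        filter_upwards [e.open_target.mem_nhds hz] with z hz'
        have := e.right_inv hz'
        rw [he] at this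
        exact congrArg Prod.fst this
      have h5 := h3.unique h4
      have h6 : HasFDerivAt (fun k : K => (ψ u, k)) (ContinuousLinearMap.inr ℝ F K) k :=
        hasFDerivAt_prodMk_right _ _
      have h7 := (h2.comp (ψ u, k) h1).comp k h6
      have h9 : ((fderiv ℝ f v).comp (fderiv ℝ e.symm (ψ u, k))).comp
          (ContinuousLinearMap.inr ℝ F K) = 0 := by
        ext κ
        have h8 := congrArg (fun A : F × K →L[ℝ] F => A (0, κ)) h5
        simp only [ContinuousLinearMap.comp_apply, ContinuousLinearMap.coe_fst'] at h8
        exact hker v hvU _ h8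
      rw [h9] at h7
      exact h7
    refine (convex_ball (π p) ε).is_const_of_fderivWithin_eq_zero (𝕜 := ℝ)
      (f := fun k => (f ∘ e.symm) (ψ u, k)) ?_ ?_ hu2.2 (Metric.mem_ball_self hε)
    · exact fun k hk => (hd k hk).differentiableAt.differentiableWithinAt
    · intro k hk
      rw [fderivWithin_of_isOpen Metric.isOpen_ball hk, (hd k hk).fderiv]

end LocalStructure

/-! ### Algebra and calculus of the Minkowski product. -/

section LorentzAlgebra

theorem lorentz_comm (u v : Fin 5 → ℝ) : lorentz u v = lorentz v u := by
  unfold lorentz; ring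

@[simp] theorem lorentz_add_left (u v w : Fin 5 → ℝ) :
    lorentz (u + v) w = lorentz u w + lorentz v w := by
  simp only [lorentz, Pi.add_apply]; ring

@[simp] theorem lorentz_add_right (u v w : Fin 5 → ℝ) :
    lorentz u (v + w) = lorentz u v + lorentz u w := by
  simp only [lorentz, Pi.add_apply]; ring

@[simp] theorem lorentz_sub_left (u v w : Fin 5 → ℝ) :
    lorentz (u - v) w = lorentz u w - lorentz v w := by
  simp only [lorentz, Pi.sub_apply]; ring

@[simp] theorem lorentz_smul_left (a : ℝ) (u w : Fin 5 → ℝ) :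
    lorentz (a • u) w = a * lorentz u w := by
  simp only [lorentz, Pi.smul_apply, smul_eq_mul]; ring

@[simp] theorem lorentz_smul_right (a : ℝ) (u w : Fin 5 → ℝ) :
    lorentz u (a • w) = a * lorentz u w := by
  simp only [lorentz, Pi.smul_apply, smul_eq_mul]; ring

@[simp] theorem lorentz_zero_left (w : Fin 5 → ℝ) : lorentz 0 w = 0 := by simp [lorentz]

@[simp] theorem lorentz_zero_right (w : Fin 5 → ℝ) : lorentz w 0 = 0 := by simp [lorentz]

theorem lorentz_verticalField (u : Fin 5 → ℝ) : lorentz u verticalField = u 4 := by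
  simp [lorentz, verticalField]

/-- The Minkowski product as a continuous bilinear form. -/
noncomputable def lorentzForm : (Fin 5 → ℝ) →L[ℝ] (Fin 5 → ℝ) →L[ℝ] ℝ :=
  LinearMap.toContinuousLinearMap
    ((LinearMap.toContinuousLinearMap (𝕜 := ℝ) (E := Fin 5 → ℝ) (F' := ℝ)).toLinearMap ∘ₗ
      LinearMap.mk₂ ℝ lorentz lorentz_add_left (fun a u w => lorentz_smul_left a u w)
        lorentz_add_right (fun a u w => lorentz_smul_right a u w))

theorem lorentzForm_apply (u v : Fin 5 → ℝ) : lorentzForm u v = lorentz u v := rfl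

section Calculus

variable {E : Type*} [NormedAddCommGroup E] [NormedSpace ℝ E] {f g : E → Fin 5 → ℝ}

theorem ContDiffOn.lorentz {U : Set E} {n : WithTop ℕ∞} (hf : ContDiffOn ℝ n f U)
    (hg : ContDiffOn ℝ n g U) : ContDiffOn ℝ n (fun u => lorentz (f u) (g u)) U := by
  simp only [← lorentzForm_apply]
  exact (lorentzForm.contDiff.comp_contDiffOn hf).clm_apply hg

theorem DifferentiableAt.lorentz {u : E} (hf : DifferentiableAt ℝ f u)
    (hg : DifferentiableAt ℝ g u) : DifferentiableAt ℝ (fun u => lorentz (f u) (g u)) u := by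
  simp only [← lorentzForm_apply]
  exact (lorentzForm.hasFDerivAt_of_bilinear hf.hasFDerivAt hg.hasFDerivAt).differentiableAt

theorem fderiv_lorentz {u : E} (hf : DifferentiableAt ℝ f u) (hg : DifferentiableAt ℝ g u) (X : E) :
    fderiv ℝ (fun u => lorentz (f u) (g u)) u X =
      lorentz (f u) (fderiv ℝ g u X) + lorentz (fderiv ℝ f u X) (g u) := by
  have h := lorentzForm.hasFDerivAt_of_bilinear hf.hasFDerivAt hg.hasFDerivAt
  simp only [lorentzForm_apply] at h
  rw [h.fderiv]
  simp [lorentzForm_apply]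

theorem HasDerivAt.lorentz {f g : ℝ → Fin 5 → ℝ} {f' g' : Fin 5 → ℝ} {t : ℝ}
    (hf : HasDerivAt f f' t) (hg : HasDerivAt g g' t) :
    HasDerivAt (fun t => lorentz (f t) (g t)) (lorentz (f t) g' + lorentz f' (g t)) t := by
  have h := (lorentzForm.hasFDerivAt_of_bilinear hf.hasFDerivAt hg.hasFDerivAt).hasDerivAt
  simpa [lorentzForm_apply] using h

/-- Differentiating a constant Minkowski product. -/
theorem lorentz_fderiv_of_eventually_const {u : E} (hf : DifferentiableAt ℝ f u)
    (hg : DifferentiableAt ℝ g u) {c : ℝ} (h : ∀ᶠ v in 𝓝 u, _root_.lorentz (f v) (g v) = c)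
    (X : E) : _root_.lorentz (f u) (fderiv ℝ g u X) + _root_.lorentz (fderiv ℝ f u X) (g u) = 0 := by
  rw [← fderiv_lorentz hf hg, Filter.EventuallyEq.fderiv_eq (f := fun _ => c) h]
  simp

theorem lorentz_deriv_of_eventually_const {f g : ℝ → Fin 5 → ℝ} {f' g' : Fin 5 → ℝ} {t : ℝ}
    (hf : HasDerivAt f f' t) (hg : HasDerivAt g g' t) {c : ℝ}
    (h : ∀ᶠ s in 𝓝 t, _root_.lorentz (f s) (g s) = c) :
    _root_.lorentz (f t) g' + _root_.lorentz f' (g t) = 0 := by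
  have h1 : HasDerivAt (fun t => _root_.lorentz (f t) (g t)) 0 t :=
    (hasDerivAt_const t c).congr_of_eventuallyEq h
  exact (hf.lorentz hg).unique h1

end Calculus

/-- A vector orthogonal to a unit timelike vector is spacelike or zero. -/
theorem lorentz_self_pos_of_orthogonal {y v : Fin 5 → ℝ} (hy : lorentz y y = -1)
    (hv : lorentz v y = 0) (hne : v ≠ 0) : 0 < lorentz v v := by
  unfold lorentz at *
  -- Cauchy–Schwarz for the spatial parts. With q the spatial square of v, orthogonality and the
  -- norm of y turn it into q ≤ y₀² (q - v₀²), which forces q > v₀² once q > 0.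
  have hcs : (v 1 * y 1 + v 2 * y 2 + v 3 * y 3 + v 4 * y 4) ^ 2 ≤
      (v 1 ^ 2 + v 2 ^ 2 + v 3 ^ 2 + v 4 ^ 2) * (y 1 ^ 2 + y 2 ^ 2 + y 3 ^ 2 + y 4 ^ 2) := by
    nlinarith [sq_nonneg (v 1 * y 2 - v 2 * y 1), sq_nonneg (v 1 * y 3 - v 3 * y 1),
      sq_nonneg (v 1 * y 4 - v 4 * y 1), sq_nonneg (v 2 * y 3 - v 3 * y 2),
      sq_nonneg (v 2 * y 4 - v 4 * y 2), sq_nonneg (v 3 * y 4 - v 4 * y 3)]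
  have h1 : v 1 * y 1 + v 2 * y 2 + v 3 * y 3 + v 4 * y 4 = v 0 * y 0 := by linarith
  have h2 : y 1 ^ 2 + y 2 ^ 2 + y 3 ^ 2 + y 4 ^ 2 = y 0 ^ 2 - 1 := by linarith
  rw [h1, h2] at hcs
  have hy0 : 0 < y 0 ^ 2 := by
    have := sq_nonneg (y 1)
    have := sq_nonneg (y 2)
    have := sq_nonneg (y 3)
    have := sq_nonneg (y 4)
    linarith
  obtain ⟨q, hq⟩ : ∃ q, q = v 1 ^ 2 + v 2 ^ 2 + v 3 ^ 2 + v 4 ^ 2 := ⟨_, rfl⟩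
  rw [← hq] at hcs
  have h3 : q ≤ y 0 ^ 2 * (q - v 0 ^ 2) := by nlinarith
  have h4 : 0 < q := by
    by_contra hcon
    have := sq_nonneg (v 1)
    have := sq_nonneg (v 2)
    have := sq_nonneg (v 3)
    have := sq_nonneg (v 4)
    have hv1 : v 1 ^ 2 = 0 := by linarith
    have hv2 : v 2 ^ 2 = 0 := by linarith
    have hv3 : v 3 ^ 2 = 0 := by linarith
    have hv4 : v 4 ^ 2 = 0 := by linarith
    have e1 := (pow_eq_zero_iff two_ne_zero).1 hv1
    have e2 := (pow_eq_zero_iff two_ne_zero).1 hv2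
    have e3 := (pow_eq_zero_iff two_ne_zero).1 hv3
    have e4 := (pow_eq_zero_iff two_ne_zero).1 hv4
    have hy0' : y 0 ≠ 0 := fun h => by simp [h] at hy0
    have e0 : v 0 = 0 := by
      rw [e1, e2, e3, e4] at h1
      have : v 0 * y 0 = 0 := by linarith
      exact (mul_eq_zero.1 this).resolve_right hy0'
    exact hne (by ext i; fin_cases i <;> simp [e0, e1, e2, e3, e4])
  have h5 : 0 < q - v 0 ^ 2 := by
    by_contra hcon
    nlinarith
  nlinarith

theorem mem_H3R_iff {p : Fin 5 → ℝ} :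
    p ∈ H3R ↔ lorentz p p - p 4 ^ 2 = -1 ∧ 0 < p 0 := by
  simp only [H3R, mem_ofPred_eq, lorentz]
  constructor <;> rintro ⟨h1, h2⟩ <;> exact ⟨by linarith, h2⟩

/-- Two unit timelike vectors of the same height are future directed simultaneously. -/
theorem pos_iff_lorentz_neg {p q : Fin 5 → ℝ} (hp : lorentz p p - p 4 ^ 2 = -1) (hq : q ∈ H3R)
    (hq4 : q 4 = 0) : 0 < p 0 ↔ lorentz p q < 0 := by
  obtain ⟨h1, h2⟩ := mem_H3R_iff.1 hq
  unfold lorentz at *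
  have hcs : (p 1 * q 1 + p 2 * q 2 + p 3 * q 3) ^ 2 ≤
      (p 1 ^ 2 + p 2 ^ 2 + p 3 ^ 2) * (q 1 ^ 2 + q 2 ^ 2 + q 3 ^ 2) := by
    nlinarith [sq_nonneg (p 1 * q 2 - p 2 * q 1), sq_nonneg (p 1 * q 3 - p 3 * q 1),
      sq_nonneg (p 2 * q 3 - p 3 * q 2)]
  have e1 : p 1 ^ 2 + p 2 ^ 2 + p 3 ^ 2 = p 0 ^ 2 - 1 := by linarith
  have e2 : q 1 ^ 2 + q 2 ^ 2 + q 3 ^ 2 = q 0 ^ 2 - 1 := by rw [hq4] at h1; linarith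
  rw [e1, e2] at hcs
  have hp0 : 1 ≤ p 0 ^ 2 := by nlinarith [sq_nonneg (p 1), sq_nonneg (p 2), sq_nonneg (p 3)]
  have hq0 : 1 ≤ q 0 ^ 2 := by nlinarith [sq_nonneg (q 1), sq_nonneg (q 2), sq_nonneg (q 3)]
  set m := p 1 * q 1 + p 2 * q 2 + p 3 * q 3 with hm
  have hlt : m ^ 2 < (p 0 * q 0) ^ 2 := by nlinarith
  have habs := sq_lt_sq.1 hlt
  rw [hq4]
  constructor
  · intro h
    have := abs_of_pos (mul_pos h h2)
    have := le_abs_self m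
    linarith
  · intro h
    by_contra hcon
    have h5 : p 0 * q 0 ≤ 0 := mul_nonpos_of_nonpos_of_nonneg (not_lt.1 hcon) h2.le
    have := abs_of_nonpos h5
    have := neg_abs_le m
    linarith

end LorentzAlgebra

/-! ### Isometries fixing the vertical direction, and projections onto Lorentzian planes. -/

section Frames

/-- The linear isometries of `ℍ³ × ℝ` that fix the vertical field. -/
structure IsVerticalIsometry (Φ : (Fin 5 → ℝ) ≃ₗ[ℝ] (Fin 5 → ℝ)) : Prop where
  toIsLinearIsometryH3R : IsLinearIsometryH3R Φ
  map_vertical : Φ verticalField = verticalField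

/-- The projection of Minkowski space onto the first two coordinates. -/
def stdAxisProj : (Fin 5 → ℝ) →ₗ[ℝ] (Fin 5 → ℝ) where
  toFun u := ![u 0, u 1, 0, 0, 0]
  map_add' u v := by ext i; fin_cases i <;> simp
  map_smul' a u := by ext i; fin_cases i <;> simp

/-- The image under `Φ` of the projection onto the first two coordinates. -/
def axisProj (Φ : (Fin 5 → ℝ) ≃ₗ[ℝ] (Fin 5 → ℝ)) : (Fin 5 → ℝ) →ₗ[ℝ] (Fin 5 → ℝ) :=
  Φ.toLinearMap ∘ₗ stdAxisProj ∘ₗ Φ.symm.toLinearMap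

theorem axisProj_apply (Φ : (Fin 5 → ℝ) ≃ₗ[ℝ] (Fin 5 → ℝ)) (u : Fin 5 → ℝ) :
    axisProj Φ u = Φ (stdAxisProj (Φ.symm u)) := rfl

theorem axisProj_idem (Φ : (Fin 5 → ℝ) ≃ₗ[ℝ] (Fin 5 → ℝ)) (u : Fin 5 → ℝ) :
    axisProj Φ (axisProj Φ u) = axisProj Φ u := by
  simp only [axisProj_apply, LinearEquiv.symm_apply_apply]
  congr 1

variable {Φ : (Fin 5 → ℝ) ≃ₗ[ℝ] (Fin 5 → ℝ)}

theorem IsVerticalIsometry.axisProj_vertical (hΦ : IsVerticalIsometry Φ) :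
    axisProj Φ verticalField = 0 := by
  have : Φ.symm verticalField = verticalField := by
    rw [LinearEquiv.symm_apply_eq, hΦ.map_vertical]
  rw [axisProj_apply, this, ← map_zero Φ]
  congr 1
  ext i; fin_cases i <;> simp [stdAxisProj, verticalField]

theorem IsVerticalIsometry.apply_four (hΦ : IsVerticalIsometry Φ) (u : Fin 5 → ℝ) :
    Φ u 4 = u 4 := by
  rw [← lorentz_verticalField (Φ u), ← lorentz_verticalField u, ← hΦ.toIsLinearIsometryH3R.isometry u,
    hΦ.map_vertical]

/-- The right side is all that the model equation asks of Φ. As it depends on Φ only through the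
projection, isometries with equal projections are interchangeable. -/
theorem IsVerticalIsometry.lorentz_axisProj (hΦ : IsVerticalIsometry Φ) (u : Fin 5 → ℝ) :
    lorentz (axisProj Φ u) u = -(Φ.symm u 0) ^ 2 + (Φ.symm u 1) ^ 2 := by
  have h := hΦ.toIsLinearIsometryH3R.isometry (stdAxisProj (Φ.symm u)) (Φ.symm u)
  rw [LinearEquiv.apply_symm_apply] at h
  rw [axisProj_apply, h]
  simp [lorentz, stdAxisProj]; ring

theorem IsVerticalIsometry.axisProj_eq_zero (hΦ : IsVerticalIsometry Φ) {u : Fin 5 → ℝ}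
    (h0 : lorentz u (Φ (Pi.single 0 1)) = 0) (h1 : lorentz u (Φ (Pi.single 1 1)) = 0) :
    axisProj Φ u = 0 := by
  obtain ⟨z, rfl⟩ := Φ.surjective u
  rw [hΦ.toIsLinearIsometryH3R.isometry] at h0 h1
  rw [axisProj_apply, LinearEquiv.symm_apply_apply, ← map_zero Φ]
  congr 1
  simp [lorentz] at h0 h1
  ext i; fin_cases i <;> simp [stdAxisProj, h0, h1]

theorem IsVerticalIsometry.axisProj_eq_self (hΦ : IsVerticalIsometry Φ) {u : Fin 5 → ℝ}
    (h2 : lorentz u (Φ (Pi.single 2 1)) = 0) (h3 : lorentz u (Φ (Pi.single 3 1)) = 0)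
    (h4 : u 4 = 0) : axisProj Φ u = u := by
  obtain ⟨z, rfl⟩ := Φ.surjective u
  rw [hΦ.toIsLinearIsometryH3R.isometry] at h2 h3
  rw [hΦ.apply_four] at h4
  rw [axisProj_apply, LinearEquiv.symm_apply_apply]
  congr 1
  simp [lorentz] at h2 h3
  ext i; fin_cases i <;> simp [stdAxisProj, h2, h3, h4]

/-- A Minkowski-orthonormal frame adapted to the splitting defines a vertical isometry. -/
theorem exists_verticalIsometry_of_frame {f₀ f₁ f₂ f₃ : Fin 5 → ℝ}
    (h00 : lorentz f₀ f₀ = -1) (h11 : lorentz f₁ f₁ = 1) (h22 : lorentz f₂ f₂ = 1)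
    (h33 : lorentz f₃ f₃ = 1) (h01 : lorentz f₀ f₁ = 0) (h02 : lorentz f₀ f₂ = 0)
    (h03 : lorentz f₀ f₃ = 0) (h12 : lorentz f₁ f₂ = 0) (h13 : lorentz f₁ f₃ = 0)
    (h23 : lorentz f₂ f₃ = 0) (h0 : f₀ 4 = 0) (h1 : f₁ 4 = 0) (h2 : f₂ 4 = 0) (h3 : f₃ 4 = 0)
    (hpos : 0 < f₀ 0) :
    ∃ Φ : (Fin 5 → ℝ) ≃ₗ[ℝ] (Fin 5 → ℝ), IsVerticalIsometry Φ ∧ Φ (Pi.single 0 1) = f₀ ∧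
      Φ (Pi.single 1 1) = f₁ ∧ Φ (Pi.single 2 1) = f₂ ∧ Φ (Pi.single 3 1) = f₃ := by
  let A : (Fin 5 → ℝ) →ₗ[ℝ] (Fin 5 → ℝ) :=
    { toFun := fun u => u 0 • f₀ + u 1 • f₁ + u 2 • f₂ + u 3 • f₃ + u 4 • verticalField
      map_add' := fun u v => by simp only [Pi.add_apply, add_smul]; abel
      map_smul' := fun a u => by
        simp only [Pi.smul_apply, smul_eq_mul, mul_smul, smul_add, RingHom.id_apply] }
  have hA : ∀ u, A u = u 0 • f₀ + u 1 • f₁ + u 2 • f₂ + u 3 • f₃ + u 4 • verticalField := fun u => rfl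
  have hv : ∀ u, lorentz verticalField u = u 4 := fun u => by
    rw [lorentz_comm, lorentz_verticalField]
  have hv4 : verticalField 4 = 1 := by simp [verticalField]
  have hiso : ∀ u v, lorentz (A u) (A v) = lorentz u v := by
    intro u v
    rw [hA u, hA v]
    simp only [lorentz_add_left, lorentz_add_right, lorentz_smul_left, lorentz_smul_right,
      lorentz_verticalField, hv, Pi.add_apply, Pi.smul_apply, smul_eq_mul, h00, h11, h22, h33, h01, h02, h03, h12, h13, h23, h0, h1, h2, h3,
      lorentz_comm f₁ f₀, lorentz_comm f₂ f₀, lorentz_comm f₃ f₀, lorentz_comm f₂ f₁,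
      lorentz_comm f₃ f₁, lorentz_comm f₃ f₂, hv4]
    unfold lorentz
    ring
  have hinj : Function.Injective A := by
    rw [← LinearMap.ker_eq_bot, LinearMap.ker_eq_bot']
    intro u hu
    have hz : ∀ v, lorentz u v = 0 := fun v => by rw [← hiso, hu, lorentz_zero_left]
    have e0 := hz (Pi.single 0 1)
    have e1 := hz (Pi.single 1 1)
    have e2 := hz (Pi.single 2 1)
    have e3 := hz (Pi.single 3 1)
    have e4 := hz (Pi.single 4 1)
    simp [lorentz] at e0 e1 e2 e3 e4
    ext i; fin_cases i <;> simp [e0, e1, e2, e3, e4]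
  let Φ : (Fin 5 → ℝ) ≃ₗ[ℝ] (Fin 5 → ℝ) := LinearEquiv.ofInjectiveEndo A hinj
  have hΦ : ∀ u, Φ u = A u := fun u => rfl
  have hΦv : Φ verticalField = verticalField := by
    rw [hΦ, hA]
    simp [verticalField]
  have hΦ4 : ∀ u, Φ u 4 = u 4 := fun u => by
    rw [← lorentz_verticalField (Φ u), ← lorentz_verticalField u, ← hiso u, ← hΦ, ← hΦ, hΦv]
  have hs0 : Φ (Pi.single 0 1) = f₀ := by rw [hΦ, hA]; simp
  have hf₀ : f₀ ∈ H3R := mem_H3R_iff.2 ⟨by rw [h00, h0]; norm_num, hpos⟩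
  have hsingle : (Pi.single 0 1 : Fin 5 → ℝ) ∈ H3R := by simp [H3R]
  have hmem : ∀ u, Φ u ∈ H3R ↔ u ∈ H3R := by
    intro u
    have hnorm : lorentz (Φ u) (Φ u) - Φ u 4 ^ 2 = lorentz u u - u 4 ^ 2 := by
      rw [hΦ4, hΦ, hiso]
    rw [mem_H3R_iff, mem_H3R_iff, hnorm]
    refine and_congr_right fun h => ?_
    rw [pos_iff_lorentz_neg (hnorm.trans h) hf₀ h0,
      pos_iff_lorentz_neg h hsingle (by simp), ← hs0, hΦ, hΦ, hiso]
  refine ⟨Φ, ⟨⟨fun u v => hiso u v, ?_⟩, hΦv⟩, hs0, ?_, ?_, ?_⟩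
  · ext p
    constructor
    · rintro ⟨u, hu, rfl⟩
      exact (hmem u).2 hu
    · intro hp
      refine ⟨Φ.symm p, ?_, Φ.apply_symm_apply p⟩
      rw [← hmem, Φ.apply_symm_apply]
      exact hp
  all_goals rw [hΦ, hA]; simp

end Frames

/-! ### Curves with constant mutual product, and maps of rank one. -/

section Curves

theorem exists_coords_of_independent {v₀ v₁ v₂ v₃ v₄ : Fin 5 → ℝ}
    (h : ∀ a b c d e : ℝ, a • v₀ + b • v₁ + c • v₂ + d • v₃ + e • v₄ = 0 →
      a = 0 ∧ b = 0 ∧ c = 0 ∧ d = 0 ∧ e = 0) (u : Fin 5 → ℝ) :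
    ∃ a b c d e : ℝ, u = a • v₀ + b • v₁ + c • v₂ + d • v₃ + e • v₄ := by
  have hli : LinearIndependent ℝ ![v₀, v₁, v₂, v₃, v₄] := by
    rw [Fintype.linearIndependent_iff]
    intro g hg
    simp only [Fin.sum_univ_five] at hg
    obtain ⟨h0, h1, h2, h3, h4⟩ := h (g 0) (g 1) (g 2) (g 3) (g 4) hg
    intro i; fin_cases i <;> assumption
  let B := basisOfLinearIndependentOfCardEqFinrank hli (by simp)
  have hB : ∀ i, B i = ![v₀, v₁, v₂, v₃, v₄] i := fun i => by
    simp only [B, coe_basisOfLinearIndependentOfCardEqFinrank]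
  refine ⟨B.repr u 0, B.repr u 1, B.repr u 2, B.repr u 3, B.repr u 4, ?_⟩
  conv_lhs => rw [← B.sum_repr u]
  simp only [Fin.sum_univ_five, hB]
  rfl

theorem exists_smul_eq_of_mem_ker {E F : Type*} [AddCommGroup E] [Module ℝ E]
    [FiniteDimensional ℝ E] [AddCommGroup F] [Module ℝ F] {A : E →ₗ[ℝ] F}
    (hA : Function.Surjective A) (hd : Module.finrank ℝ E = Module.finrank ℝ F + 1) {X Z : E}
    (hX : A X = 0) (hX0 : X ≠ 0) (hZ : A Z = 0) : ∃ c : ℝ, Z = c • X := by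
  have h1 := LinearMap.finrank_range_add_finrank_ker A
  rw [LinearMap.range_eq_top.2 hA, finrank_top, hd] at h1
  have h2 : Module.finrank ℝ (LinearMap.ker A) = 1 := by omega
  obtain ⟨c, hc⟩ := (finrank_eq_one_iff_of_nonzero' (⟨X, hX⟩ : LinearMap.ker A)
    (fun h => hX0 (congrArg Subtype.val h))).1 h2 ⟨Z, hZ⟩
  exact ⟨c, (congrArg Subtype.val hc).symm⟩

theorem ContDiffOn.hasDerivAt_of_isOpen {F : ℝ → Fin 5 → ℝ} {I : Set ℝ} (hF : ContDiffOn ℝ ∞ F I)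
    (hI : IsOpen I) {b : ℝ} (hb : b ∈ I) : HasDerivAt F (deriv F b) b :=
  (hF.differentiableAt_of_isOpen hI hb).hasDerivAt

/-- Two curves on pseudo-spheres with constant mutual product lie in orthogonal planes. -/
theorem lorentz_eq_zero_of_const_product {F G : ℝ → Fin 5 → ℝ} {I J : Set ℝ} (hI : IsOpen I)
    (hJ : IsOpen J) (hF : ContDiffOn ℝ ∞ F I) (hG : ContDiffOn ℝ ∞ G J) {b₀ a₀ : ℝ} (hb₀ : b₀ ∈ I)
    (ha₀ : a₀ ∈ J) {c m n : ℝ} (hFG : ∀ b ∈ I, ∀ a ∈ J, lorentz (F b) (G a) = c)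
    (hFF : ∀ b ∈ I, lorentz (F b) (F b) = m) (hGG : ∀ a ∈ J, lorentz (G a) (G a) = n)
    (hdet : m * n - c ^ 2 ≠ 0) (hF4 : ∀ b ∈ I, F b 4 = 0) (hG4 : ∀ a ∈ J, G a 4 = 0)
    (hF' : lorentz (deriv F b₀) (deriv F b₀) ≠ 0) (hG' : lorentz (deriv G a₀) (deriv G a₀) ≠ 0) :
    c = 0 ∧ (∀ b ∈ I, lorentz (F b) (deriv G a₀) = 0) ∧
      (∀ a ∈ J, lorentz (deriv F b₀) (G a) = 0) ∧ lorentz (deriv F b₀) (deriv G a₀) = 0 ∧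
      lorentz (F b₀) (deriv F b₀) = 0 ∧ lorentz (G a₀) (deriv G a₀) = 0 ∧
      deriv F b₀ 4 = 0 ∧ deriv G a₀ 4 = 0 := by
  have dF : ∀ b ∈ I, HasDerivAt F (deriv F b) b := fun b hb => hF.hasDerivAt_of_isOpen hI hb
  have dG : ∀ a ∈ J, HasDerivAt G (deriv G a) a := fun a ha => hG.hasDerivAt_of_isOpen hJ ha
  have ddF : ∀ b ∈ I, HasDerivAt (deriv F) (deriv (deriv F) b) b := fun b hb =>
    (hF.deriv_of_isOpen hI le_rfl).hasDerivAt_of_isOpen hI hb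
  have ddG : ∀ a ∈ J, HasDerivAt (deriv G) (deriv (deriv G) a) a := fun a ha =>
    (hG.deriv_of_isOpen hJ le_rfl).hasDerivAt_of_isOpen hJ ha
  have dconst : ∀ (w : Fin 5 → ℝ) (t : ℝ), HasDerivAt (fun _ : ℝ => w) 0 t := fun w t =>
    hasDerivAt_const t w
  have diffL : ∀ {K : Set ℝ} (_ : IsOpen K) {P : ℝ → Fin 5 → ℝ} {P' : Fin 5 → ℝ} {t : ℝ}
      (_ : t ∈ K) (_ : HasDerivAt P P' t) {w : Fin 5 → ℝ} {k : ℝ}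
      (_ : ∀ s ∈ K, lorentz (P s) w = k), lorentz P' w = 0 := by
    intro K hK P P' t ht hP w k h
    have := lorentz_deriv_of_eventually_const hP (dconst w t)
      (by filter_upwards [hK.mem_nhds ht] with s hs using h s hs)
    simpa using this
  -- The parameters b and a vary independently, so every derivative of the constant product, pure or
  -- mixed, vanishes.
  have r1 : ∀ b ∈ I, ∀ a ∈ J, lorentz (deriv F b) (G a) = 0 := fun b hb a ha =>
    diffL hI hb (dF b hb) fun s hs => hFG s hs a ha
  have r2 : ∀ b ∈ I, ∀ a ∈ J, lorentz (F b) (deriv G a) = 0 := fun b hb a ha => by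
    rw [lorentz_comm]
    exact diffL hJ ha (dG a ha) fun s hs => by rw [lorentz_comm]; exact hFG b hb s hs
  have r3 : ∀ b ∈ I, ∀ a ∈ J, lorentz (deriv F b) (deriv G a) = 0 := fun b hb a ha =>
    diffL hI hb (dF b hb) fun s hs => r2 s hs a ha
  have r4 : ∀ a ∈ J, lorentz (deriv (deriv F) b₀) (G a) = 0 := fun a ha =>
    diffL hI hb₀ (ddF b₀ hb₀) fun s hs => r1 s hs a ha
  have r5 : ∀ a ∈ J, lorentz (deriv (deriv F) b₀) (deriv G a) = 0 := fun a ha =>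
    diffL hI hb₀ (ddF b₀ hb₀) fun s hs => r3 s hs a ha
  have r6 : lorentz (deriv (deriv F) b₀) (deriv (deriv G) a₀) = 0 := by
    rw [lorentz_comm]
    exact diffL hJ ha₀ (ddG a₀ ha₀) fun s hs => by rw [lorentz_comm]; exact r5 s hs
  have r7 : lorentz (F b₀) (deriv (deriv G) a₀) = 0 := by
    rw [lorentz_comm]
    exact diffL hJ ha₀ (ddG a₀ ha₀) fun s hs => by rw [lorentz_comm]; exact r2 b₀ hb₀ s hs
  have r8 : lorentz (deriv F b₀) (deriv (deriv G) a₀) = 0 := by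
    rw [lorentz_comm]
    exact diffL hJ ha₀ (ddG a₀ ha₀) fun s hs => by rw [lorentz_comm]; exact r3 b₀ hb₀ s hs
  have sF : ∀ b ∈ I, lorentz (F b) (deriv F b) = 0 := fun b hb => by
    have := lorentz_deriv_of_eventually_const (dF b hb) (dF b hb)
      (by filter_upwards [hI.mem_nhds hb] with s hs using hFF s hs)
    rw [lorentz_comm (deriv F b)] at this
    linarith
  have sG : ∀ a ∈ J, lorentz (G a) (deriv G a) = 0 := fun a ha => by
    have := lorentz_deriv_of_eventually_const (dG a ha) (dG a ha)
      (by filter_upwards [hJ.mem_nhds ha] with s hs using hGG s hs)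
    rw [lorentz_comm (deriv G a)] at this
    linarith
  have sF2 : lorentz (F b₀) (deriv (deriv F) b₀) + lorentz (deriv F b₀) (deriv F b₀) = 0 :=
    lorentz_deriv_of_eventually_const (dF b₀ hb₀) (ddF b₀ hb₀)
      (by filter_upwards [hI.mem_nhds hb₀] with s hs using sF s hs)
  have sG2 : lorentz (G a₀) (deriv (deriv G) a₀) + lorentz (deriv G a₀) (deriv G a₀) = 0 :=
    lorentz_deriv_of_eventually_const (dG a₀ ha₀) (ddG a₀ ha₀)
      (by filter_upwards [hJ.mem_nhds ha₀] with s hs using sG s hs)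
  have vF1 : ∀ b ∈ I, lorentz (deriv F b) verticalField = 0 := fun b hb =>
    diffL hI hb (dF b hb) fun s hs => by rw [lorentz_verticalField]; exact hF4 s hs
  have vF2 : lorentz (deriv (deriv F) b₀) verticalField = 0 :=
    diffL hI hb₀ (ddF b₀ hb₀) fun s hs => vF1 s hs
  have vG1 : lorentz (deriv G a₀) verticalField = 0 :=
    diffL hJ ha₀ (dG a₀ ha₀) fun s hs => by rw [lorentz_verticalField]; exact hG4 s hs
  have vF0 : lorentz (F b₀) verticalField = 0 := by rw [lorentz_verticalField]; exact hF4 b₀ hb₀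
  have vG0 : lorentz (G a₀) verticalField = 0 := by rw [lorentz_verticalField]; exact hG4 a₀ ha₀
  have vv : lorentz verticalField verticalField = 1 := by simp [lorentz, verticalField]
  refine ⟨?_, fun b hb => r2 b hb a₀ ha₀, fun a ha => r1 b₀ hb₀ a ha, r3 b₀ hb₀ a₀ ha₀, sF b₀ hb₀,
    sG a₀ ha₀, (lorentz_verticalField _).symm.trans (vF1 b₀ hb₀),
    (lorentz_verticalField _).symm.trans vG1⟩
  have q1 := hFG b₀ hb₀ a₀ ha₀
  have q2 := r1 b₀ hb₀ a₀ ha₀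
  have q3 := r2 b₀ hb₀ a₀ ha₀
  have q4 := r3 b₀ hb₀ a₀ ha₀
  have q5 := r4 a₀ ha₀
  have q6 := r5 a₀ ha₀
  have q7 := sF b₀ hb₀
  have q8 := sG a₀ ha₀
  have q9 := hFF b₀ hb₀
  have q10 := hGG a₀ ha₀
  have q11 := vF1 b₀ hb₀
  clear r1 r2 r3 r4 r5 sF sG dF dG ddF ddG dconst diffL hFG hFF hGG hF4 hG4 hF hG vF1
  generalize F b₀ = F₀ at *
  generalize G a₀ = G₀ at *
  generalize deriv (deriv F) b₀ = F₂ at *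
  generalize deriv (deriv G) a₀ = G₂ at *
  generalize deriv F b₀ = F₁ at *
  generalize deriv G a₀ = G₁ at *
  -- These five vectors form a basis: F₁, G₁ and the vertical vector are non-null and orthogonal to
  -- each other and to F₀, G₀, whose Gram determinant is m n - c².
  obtain ⟨p, p', q, q', e, he⟩ := exists_coords_of_independent
    (v₀ := F₀) (v₁ := F₁) (v₂ := G₀) (v₃ := G₁) (v₄ := verticalField) (by
      intro a b c' d e h
      have e1 := congrArg (fun u => lorentz u F₁) h
      have e2 := congrArg (fun u => lorentz u G₁) h
      have e3 := congrArg (fun u => lorentz u verticalField) h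
      have e4 := congrArg (fun u => lorentz u F₀) h
      have e5 := congrArg (fun u => lorentz u G₀) h
      simp only [lorentz_add_left, lorentz_smul_left, lorentz_zero_left, lorentz_comm F₁ F₀,
        lorentz_comm G₀ F₀, lorentz_comm G₁ F₀, lorentz_comm G₀ F₁, lorentz_comm G₁ F₁,
        lorentz_comm G₁ G₀, lorentz_comm verticalField, q1, q2, q3, q4, q7, q8, q9, q10, q11, vF0,
        vG0, vG1, vv, mul_zero, add_zero, zero_add, mul_one] at e1 e2 e3 e4 e5
      have ha : a * (m * n - c ^ 2) = 0 := by linear_combination n * e4 - c * e5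
      have hc : c' * (m * n - c ^ 2) = 0 := by linear_combination m * e5 - c * e4
      exact ⟨(mul_eq_zero.1 ha).resolve_right hdet, (mul_eq_zero.1 e1).resolve_right hF',
        (mul_eq_zero.1 hc).resolve_right hdet, (mul_eq_zero.1 e2).resolve_right hG', e3⟩) F₂
  have e1 := congrArg (fun u => lorentz u G₁) he
  have e2 := congrArg (fun u => lorentz u G₂) he
  have e3 := congrArg (fun u => lorentz u G₀) he
  have e4 := congrArg (fun u => lorentz u F₀) he
  have e5 := congrArg (fun u => lorentz u verticalField) he
  simp only [lorentz_add_left, lorentz_smul_left, lorentz_comm F₁ F₀,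
    lorentz_comm G₀ F₀, lorentz_comm G₁ F₀, lorentz_comm G₁ G₀, lorentz_comm verticalField, q1, q2, q3, q4, q5, q6, q7, q8, q9, q10, q11,
    vF0, vG0, vG1, vv, vF2, r6, r7, r8, mul_zero, add_zero, zero_add, mul_one] at e1 e2 e3 e4 e5
  -- In the expansion of F₂, pairing with G₁ and then G₂ kills the coefficients of G₁ and G₀.
  -- Pairing with F₀ leaves p m = -⟨F₁, F₁⟩ ≠ 0, and pairing with G₀ leaves p c = 0.
  have hq' : q' = 0 := (mul_eq_zero.1 e1.symm).resolve_right hG'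
  rw [← e5, hq'] at e2
  have hq : q = 0 := by
    have h1 : q * lorentz G₁ G₁ = 0 := by linear_combination q * sG2 + e2
    exact (mul_eq_zero.1 h1).resolve_right hG'
  rw [hq] at e3 e4
  have hp : p ≠ 0 := by
    rintro rfl
    apply hF'
    rw [lorentz_comm F₂ F₀] at e4
    linear_combination sF2 - e4
  have h1 : p * c = 0 := by linear_combination -e3
  exact (mul_eq_zero.1 h1).resolve_left hp

/-- A map of rank one from the plane to Minkowski space factors locally through a curve. -/
theorem exists_curve_factor {F : ℝ × ℝ → Fin 5 → ℝ} {Ω : Set (ℝ × ℝ)} (hΩ : IsOpen Ω)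
    (hF : ContDiffOn ℝ ∞ F Ω) {z₀ : ℝ × ℝ} (hz₀ : z₀ ∈ Ω)
    (hX : ∀ z ∈ Ω, ∃ X, X ≠ 0 ∧ fderiv ℝ F z X = 0) {Y : ℝ × ℝ}
    (hY : 0 < lorentz (fderiv ℝ F z₀ Y) (fderiv ℝ F z₀ Y)) :
    ∃ (I : Set ℝ) (W : Set (ℝ × ℝ)) (c : ℝ → Fin 5 → ℝ) (φ : ℝ × ℝ → ℝ), IsOpen I ∧ IsOpen W ∧
      z₀ ∈ W ∧ W ⊆ Ω ∧ ContDiffOn ℝ ∞ c I ∧ ContDiffOn ℝ ∞ φ Ω ∧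
      (∀ z ∈ W, φ z ∈ I ∧ F z = c (φ z)) ∧
      (∀ X, fderiv ℝ φ z₀ X = lorentz (fderiv ℝ F z₀ X) (fderiv ℝ F z₀ Y)) ∧
      0 < lorentz (deriv c (φ z₀)) (deriv c (φ z₀)) := by
  set v := fderiv ℝ F z₀ Y with hv
  -- Pairing with v gives a function with nonzero derivative along Y near z₀. In the plane its
  -- differential has a one-dimensional kernel, which the kernel vector of dF already spans.
  let φ : ℝ × ℝ → ℝ := fun z => lorentz (F z) v
  have hφ : ContDiffOn ℝ ∞ φ Ω := hF.lorentz contDiffOn_const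
  have hdφ : ∀ z ∈ Ω, ∀ X, fderiv ℝ φ z X = lorentz (fderiv ℝ F z X) v := by
    intro z hz X
    have := fderiv_lorentz (hF.differentiableAt_of_isOpen hΩ hz)
      (differentiableAt_const (c := v)) X
    simpa [φ] using this
  have hcont : ContinuousOn (fun z => fderiv ℝ φ z) Ω := hφ.continuousOn_fderiv_of_isOpen hΩ (by simp)
  let Ω' := Ω ∩ (fun z => fderiv ℝ φ z Y) ⁻¹' {0}ᶜ
  have hΩ' : IsOpen Ω' := (hcont.clm_apply continuousOn_const).isOpen_inter_preimage hΩ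
    isClosed_singleton.isOpen_compl
  have hsurj : ∀ z ∈ Ω', Function.Surjective (fderiv ℝ φ z) := by
    intro z hz s
    refine ⟨(s / fderiv ℝ φ z Y) • Y, ?_⟩
    rw [map_smul, smul_eq_mul, div_mul_cancel₀ _ hz.2]
  have hz₀' : z₀ ∈ Ω' := ⟨hz₀, by
    simp only [mem_preimage, hdφ z₀ hz₀, ← hv]
    exact hY.ne'⟩
  obtain ⟨I, W, c, hI, hW, hzW, hWΩ, hc, hfac⟩ := exists_factor_through_submersion hΩ'
    (hφ.mono inter_subset_left) (hF.mono inter_subset_left) hz₀' (hsurj z₀ hz₀') (by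
      intro z hz Z hZ
      obtain ⟨X, hX0, hFX⟩ := hX z hz.1
      obtain ⟨k, rfl⟩ := exists_smul_eq_of_mem_ker (A := (fderiv ℝ φ z).toLinearMap) (hsurj z hz)
        (by simp) (X := X) (by
          change fderiv ℝ φ z X = 0
          rw [hdφ z hz.1, hFX, lorentz_zero_left]) hX0 hZ
      rw [map_smul, hFX, smul_zero])
  refine ⟨I, W, c, φ, hI, hW, hzW, fun z hz => (hWΩ hz).1, hc, hφ, hfac, hdφ z₀ hz₀, ?_⟩
  have hdc := hc.hasDerivAt_of_isOpen hI (hfac z₀ hzW).1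
  have h1 : fderiv ℝ F z₀ Y = fderiv ℝ φ z₀ Y • deriv c (φ z₀) := by
    have h2 : HasFDerivAt (fun z => c (φ z)) (fderiv ℝ F z₀) z₀ := by
      refine (hF.differentiableAt_of_isOpen hΩ hz₀).hasFDerivAt.congr_of_eventuallyEq ?_
      filter_upwards [hW.mem_nhds hzW] with z hz using (hfac z hz).2.symm
    have h3 : HasFDerivAt (fun z => c (φ z)) _ z₀ :=
      hdc.hasFDerivAt.comp z₀ (hφ.differentiableAt_of_isOpen hΩ hz₀).hasFDerivAt
    rw [h2.unique h3]
    simp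
  rw [hdφ z₀ hz₀, ← hv] at h1
  have h4 := hY
  rw [h1, lorentz_smul_left, lorentz_smul_right] at h4
  nlinarith [mul_self_nonneg (lorentz v v)]

end Curves

/-! ### Surfaces in ℍ³ with distinct constant principal curvatures. -/

section Surfaces

/-- A surface in hyperbolic 3-space with distinct constant principal curvatures has
`λ₂ * λ₃ = 1` and is an open part of a tube around a geodesic. -/
theorem exists_axis_of_const_principal_curvatures {g ξ : ℝ × ℝ → Fin 5 → ℝ} {Ω : Set (ℝ × ℝ)}
    (hΩ : IsOpen Ω) (hg : ContDiffOn ℝ ∞ g Ω) (hξ : ContDiffOn ℝ ∞ ξ Ω) {z₀ : ℝ × ℝ} (hz₀ : z₀ ∈ Ω)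
    (hgg : ∀ z ∈ Ω, lorentz (g z) (g z) = -1) (hgξ : ∀ z ∈ Ω, lorentz (g z) (ξ z) = 0)
    (hξξ : ∀ z ∈ Ω, lorentz (ξ z) (ξ z) = 1) (hg4 : ∀ z ∈ Ω, g z 4 = 0) (hξ4 : ∀ z ∈ Ω, ξ z 4 = 0)
    {l₂ l₃ : ℝ} (hl : l₂ ≠ l₃)
    (hX : ∀ z ∈ Ω, ∃ X₂ X₃, fderiv ℝ g z X₂ ≠ 0 ∧ fderiv ℝ g z X₃ ≠ 0 ∧
      fderiv ℝ ξ z X₂ = -l₂ • fderiv ℝ g z X₂ ∧ fderiv ℝ ξ z X₃ = -l₃ • fderiv ℝ g z X₃) :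
    l₂ * l₃ = 1 ∧ (1 < l₃ ^ 2 → ∃ Φ : (Fin 5 → ℝ) ≃ₗ[ℝ] (Fin 5 → ℝ), IsVerticalIsometry Φ ∧
      ∀ᶠ z in 𝓝 z₀, axisProj Φ (ξ z + l₂ • g z) = 0 ∧
        axisProj Φ (ξ z + l₃ • g z) = ξ z + l₃ • g z) := by
  have dg : ∀ z ∈ Ω, DifferentiableAt ℝ g z := fun z hz => hg.differentiableAt_of_isOpen hΩ hz
  have dξ : ∀ z ∈ Ω, DifferentiableAt ℝ ξ z := fun z hz => hξ.differentiableAt_of_isOpen hΩ hz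
  have hdF : ∀ l : ℝ, ∀ z ∈ Ω, ∀ X, fderiv ℝ (fun z => ξ z + l • g z) z X =
      fderiv ℝ ξ z X + l • fderiv ℝ g z X := by
    intro l z hz X
    have := ((dξ z hz).hasFDerivAt.add ((dg z hz).hasFDerivAt.const_smul l)).fderiv
    change fderiv ℝ (ξ + l • g) z X = _
    rw [this]
    simp
  have hsm : ∀ l : ℝ, ContDiffOn ℝ ∞ (fun z => ξ z + l • g z) Ω := fun l =>
    hξ.add (hg.const_smul l)
  have hgX : ∀ X, lorentz (fderiv ℝ g z₀ X) (g z₀) = 0 := by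
    intro X
    have := lorentz_fderiv_of_eventually_const (dg z₀ hz₀) (dg z₀ hz₀)
      (by filter_upwards [hΩ.mem_nhds hz₀] with z hz using hgg z hz) X
    rw [lorentz_comm (g z₀)] at this
    linarith
  obtain ⟨X₂, X₃, h2, h3, h2', h3'⟩ := hX z₀ hz₀
  have pos : ∀ {l l' : ℝ} {X : ℝ × ℝ}, l ≠ l' → fderiv ℝ g z₀ X ≠ 0 →
      fderiv ℝ ξ z₀ X = -l • fderiv ℝ g z₀ X →
      0 < lorentz (fderiv ℝ (fun z => ξ z + l' • g z) z₀ X)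
        (fderiv ℝ (fun z => ξ z + l' • g z) z₀ X) := by
    intro l l' X hne h0 h
    have e : fderiv ℝ (fun z => ξ z + l' • g z) z₀ X = (l' - l) • fderiv ℝ g z₀ X := by
      rw [hdF l' z₀ hz₀, h]; module
    rw [e, lorentz_smul_left, lorentz_smul_right, ← mul_assoc]
    exact mul_pos (mul_self_pos.2 (sub_ne_zero.2 hne.symm))
      (lorentz_self_pos_of_orthogonal (hgg z₀ hz₀) (hgX X) h0)
  have zero : ∀ {l : ℝ} {X : ℝ × ℝ} {z : ℝ × ℝ}, z ∈ Ω → fderiv ℝ ξ z X = -l • fderiv ℝ g z X →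
      fderiv ℝ (fun z => ξ z + l • g z) z X = 0 := by
    intro l X z hz h
    rw [hdF l z hz, h]; module
  -- The direction X₂ is killed by d(ξ + l₂ g), whereas X₃ has spacelike image because l₂ ≠ l₃; the
  -- roles are exchanged for ξ + l₃ g.
  obtain ⟨I, W, F, φ, hI, hW, hzW, hWΩ, hF, hφ, hFφ, hdφ, hFpos⟩ := exists_curve_factor hΩ (hsm l₂) hz₀
    (fun z hz => by
      obtain ⟨X, -, h, -, h', -⟩ := hX z hz
      exact ⟨X, fun h0 => h (by rw [h0, map_zero]), zero hz h'⟩) (pos hl.symm h3 h3')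
  obtain ⟨J, W', G, γ, hJ, hW', hzW', hWΩ', hG, hγ, hGγ, hdγ, hGpos⟩ := exists_curve_factor hΩ (hsm l₃)
    hz₀ (fun z hz => by
      obtain ⟨-, X, -, h, -, h'⟩ := hX z hz
      exact ⟨X, fun h0 => h (by rw [h0, map_zero]), zero hz h'⟩) (pos hl h2 h2')
  have hφX2 : fderiv ℝ φ z₀ X₂ = 0 := by rw [hdφ, zero hz₀ h2', lorentz_zero_left]
  have hγX3 : fderiv ℝ γ z₀ X₃ = 0 := by rw [hdγ, zero hz₀ h3', lorentz_zero_left]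
  have hφX3 : fderiv ℝ φ z₀ X₃ ≠ 0 := by rw [hdφ]; exact (pos hl.symm h3 h3').ne'
  have hγX2 : fderiv ℝ γ z₀ X₂ ≠ 0 := by rw [hdγ]; exact (pos hl h2 h2').ne'
  -- On X₃, X₂ the differential of (φ, γ) is diagonal with nonzero entries. So (φ, γ) is open at z₀
  -- and the two curve parameters fill a product of intervals.
  have hmap : Filter.map (fun z => (φ z, γ z)) (𝓝 z₀) = 𝓝 (φ z₀, γ z₀) := by
    have hs : HasStrictFDerivAt (fun z => (φ z, γ z)) ((fderiv ℝ φ z₀).prod (fderiv ℝ γ z₀)) z₀ :=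
      ((hφ.contDiffAt (hΩ.mem_nhds hz₀)).hasStrictFDerivAt (by simp)).prodMk
        ((hγ.contDiffAt (hΩ.mem_nhds hz₀)).hasStrictFDerivAt (by simp))
    refine hs.map_nhds_eq_of_surj (LinearMap.range_eq_top.2 ?_)
    rintro ⟨s, t⟩
    refine ⟨(s / fderiv ℝ φ z₀ X₃) • X₃ + (t / fderiv ℝ γ z₀ X₂) • X₂, ?_⟩
    ext <;> simp [hφX2, hγX3, hφX3, hγX2]
  have himg : (fun z => (φ z, γ z)) '' (W ∩ W') ∈ 𝓝 (φ z₀, γ z₀) := by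
    rw [← hmap]
    exact image_mem_map ((hW.inter hW').mem_nhds ⟨hzW, hzW'⟩)
  obtain ⟨ε, hε, hball⟩ := Metric.mem_nhds_iff.1 himg
  rw [← ball_prod_same] at hball
  have hrel : ∀ b ∈ Metric.ball (φ z₀) ε, ∀ a ∈ Metric.ball (γ z₀) ε, b ∈ I ∧ a ∈ J ∧
      ∃ z ∈ Ω, F b = ξ z + l₂ • g z ∧ G a = ξ z + l₃ • g z := by
    intro b hb a ha
    obtain ⟨z, hz, hzz⟩ := hball (show (b, a) ∈ _ from ⟨hb, ha⟩)
    obtain ⟨rfl, rfl⟩ := Prod.mk.inj hzz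
    exact ⟨(hFφ z hz.1).1, (hGγ z hz.2).1, z, hWΩ hz.1, (hFφ z hz.1).2.symm, (hGγ z hz.2).2.symm⟩
  have hprod : ∀ z ∈ Ω, ∀ l l' : ℝ, lorentz (ξ z + l • g z) (ξ z + l' • g z) = 1 - l * l' := by
    intro z hz l l'
    simp only [lorentz_add_left, lorentz_add_right, lorentz_smul_left, lorentz_smul_right,
      lorentz_comm (ξ z) (g z), hgg z hz, hgξ z hz, hξξ z hz]
    ring
  have hb0 := Metric.mem_ball_self (x := φ z₀) hε
  have ha0 := Metric.mem_ball_self (x := γ z₀) hε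
  have rFG : ∀ b ∈ Metric.ball (φ z₀) ε, ∀ a ∈ Metric.ball (γ z₀) ε,
      lorentz (F b) (G a) = 1 - l₂ * l₃ := by
    intro b hb a ha
    obtain ⟨-, -, z, hz, e, e'⟩ := hrel b hb a ha
    rw [e, e', hprod z hz]
  have rFF : ∀ b ∈ Metric.ball (φ z₀) ε, lorentz (F b) (F b) = 1 - l₂ * l₂ := by
    intro b hb
    obtain ⟨-, -, z, hz, e, e'⟩ := hrel b hb _ ha0
    rw [e, hprod z hz]
  have rGG : ∀ a ∈ Metric.ball (γ z₀) ε, lorentz (G a) (G a) = 1 - l₃ * l₃ := by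
    intro a ha
    obtain ⟨-, -, z, hz, e, e'⟩ := hrel _ hb0 a ha
    rw [e', hprod z hz]
  have rF4 : ∀ b ∈ Metric.ball (φ z₀) ε, F b 4 = 0 := by
    intro b hb
    obtain ⟨-, -, z, hz, e, e'⟩ := hrel b hb _ ha0
    rw [e]; simp [hξ4 z hz, hg4 z hz]
  have rG4 : ∀ a ∈ Metric.ball (γ z₀) ε, G a 4 = 0 := by
    intro a ha
    obtain ⟨-, -, z, hz, e, e'⟩ := hrel _ hb0 a ha
    rw [e']; simp [hξ4 z hz, hg4 z hz]
  obtain ⟨hc, o1, o2, o3, o4, o5, o6, o7⟩ := lorentz_eq_zero_of_const_product Metric.isOpen_ball Metric.isOpen_ball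
    (hF.mono fun b hb => (hrel b hb _ ha0).1) (hG.mono fun a ha => (hrel _ hb0 a ha).2.1) hb0 ha0
    rFG rFF rGG (by
      have : (1 - l₂ * l₂) * (1 - l₃ * l₃) - (1 - l₂ * l₃) ^ 2 = -((l₂ - l₃) ^ 2) := by ring
      rw [this]
      exact neg_ne_zero.2 (pow_ne_zero 2 (sub_ne_zero.2 hl))) rF4 rG4 hFpos.ne' hGpos.ne'
  refine ⟨by linarith, fun hl3 => ?_⟩
  have hFn : 0 < 1 - l₂ * l₂ := by
    have h1 : l₂ ^ 2 * l₃ ^ 2 = 1 := by rw [← mul_pow, show l₂ * l₃ = 1 by linarith, one_pow]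
    nlinarith [sq_nonneg l₂]
  have hGn : 0 < -(1 - l₃ * l₃) := by nlinarith
  have rFF0 := rFF _ hb0
  have rGG0 := rGG _ ha0
  have rF40 := rF4 _ hb0
  have rG40 := rG4 _ ha0
  have rFG0 := rFG _ hb0 _ ha0
  rw [hc] at rFG rFG0
  have o10 := o1 _ hb0
  have o20 := o2 _ ha0
  have hG00 : G (γ z₀) 0 ≠ 0 := by
    intro h
    have h1 := rGG0
    unfold lorentz at h1
    rw [h, rG40] at h1
    nlinarith [mul_self_nonneg (G (γ z₀) 1), mul_self_nonneg (G (γ z₀) 2),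
      mul_self_nonneg (G (γ z₀) 3)]
  -- G is timelike but may point to the past; the sign s makes the first frame vector future
  -- directed.
  obtain ⟨s, hs, hspos⟩ : ∃ s : ℝ, s * s = 1 ∧ 0 < s * G (γ z₀) 0 := by
    rcases lt_or_gt_of_ne hG00 with h | h
    · exact ⟨-1, by norm_num, by linarith⟩
    · exact ⟨1, by norm_num, by linarith⟩
  have key : ∀ {t : ℝ}, 0 < t → (√t)⁻¹ * ((√t)⁻¹ * t) = 1 := by
    intro t ht
    have h1 : √t ≠ 0 := (Real.sqrt_pos.2 ht).ne'
    field_simp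
    exact (Real.sq_sqrt ht.le).symm
  obtain ⟨Φ, hΦ, f0, f1, f2, f3⟩ := exists_verticalIsometry_of_frame
    (f₀ := (√(-(1 - l₃ * l₃)))⁻¹ • s • G (γ z₀))
    (f₁ := (√(lorentz (deriv G (γ z₀)) (deriv G (γ z₀))))⁻¹ • deriv G (γ z₀))
    (f₂ := (√(1 - l₂ * l₂))⁻¹ • F (φ z₀))
    (f₃ := (√(lorentz (deriv F (φ z₀)) (deriv F (φ z₀))))⁻¹ • deriv F (φ z₀))
    (by
      simp only [lorentz_smul_left, lorentz_smul_right, rGG0]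
      linear_combination (-(s * s)) * key hGn - hs)
    (by simp only [lorentz_smul_left, lorentz_smul_right]; exact key hGpos)
    (by simp only [lorentz_smul_left, lorentz_smul_right, rFF0]; exact key hFn)
    (by simp only [lorentz_smul_left, lorentz_smul_right]; exact key hFpos)
    (by simp [o5]) (by simp [lorentz_comm (G _), rFG0]) (by simp [lorentz_comm (G _), o20])
    (by simp [lorentz_comm (deriv G _), o10]) (by simp [lorentz_comm (deriv G _), o3]) (by simp [o4])
    (by simp [rG40]) (by simp [o7]) (by simp [rF40]) (by simp [o6])
    (by
      simp only [Pi.smul_apply, smul_eq_mul]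
      exact mul_pos (inv_pos.2 (Real.sqrt_pos.2 hGn)) hspos)
  refine ⟨Φ, hΦ, ?_⟩
  have hnear : ∀ᶠ z in 𝓝 z₀, (φ z, γ z) ∈ Metric.ball (φ z₀) ε ×ˢ Metric.ball (γ z₀) ε :=
    (((hφ.contDiffAt (hΩ.mem_nhds hz₀)).continuousAt.prodMk
      (hγ.contDiffAt (hΩ.mem_nhds hz₀)).continuousAt)).eventually_mem
      (prod_mem_nhds (Metric.ball_mem_nhds _ hε) (Metric.ball_mem_nhds _ hε))
  filter_upwards [hnear, (hW.inter hW').mem_nhds ⟨hzW, hzW'⟩] with z hz hzWW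
  obtain ⟨hzb, hza⟩ := hz
  rw [(hFφ z hzWW.1).2, (hGγ z hzWW.2).2]
  constructor
  · refine hΦ.axisProj_eq_zero ?_ ?_
    · rw [f0]; simp [rFG _ hzb _ ha0]
    · rw [f1]; simp [o1 _ hzb]
  · refine hΦ.axisProj_eq_self ?_ ?_ (rG4 _ hza)
    · rw [f2, lorentz_comm]; simp [rFG _ hb0 _ hza]
    · rw [f3, lorentz_comm]; simp [o2 _ hza]

end Surfaces

/-! ### From one slice to the neighbouring parallel slices. -/

section Splitting

theorem exists_smooth_antideriv {f : ℝ → ℝ} {c ε : ℝ} (hε : 0 < ε)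
    (hf : ContDiffOn ℝ ∞ f (Metric.ball c ε)) :
    ∃ R : ℝ → ℝ, ContDiffOn ℝ ∞ R (Metric.ball c ε) ∧ R c = 0 ∧
      ∀ t ∈ Metric.ball c ε, HasDerivAt R (f t) t := by
  have hd : ∀ t ∈ Metric.ball c ε, HasDerivAt (fun t => ∫ s in c..t, f s) (f t) t := by
    intro t ht
    have hsub : uIcc c t ⊆ Metric.ball c ε :=
      (convex_ball c ε).ordConnected.uIcc_subset (Metric.mem_ball_self hε) ht
    refine intervalIntegral.integral_hasDerivAt_right
      ((hf.continuousOn.mono hsub).intervalIntegrable) ?_ ?_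
    · exact hf.continuousOn.stronglyMeasurableAtFilter Metric.isOpen_ball t ht
    · exact hf.continuousOn.continuousAt (Metric.isOpen_ball.mem_nhds ht)
  refine ⟨fun t => ∫ s in c..t, f s, ?_, by simp, hd⟩
  rw [contDiffOn_infty_iff_deriv_of_isOpen Metric.isOpen_ball]
  refine ⟨fun t ht => (hd t ht).differentiableAt.differentiableWithinAt, ?_⟩
  exact hf.congr fun t ht => (hd t ht).deriv

/-- Along T the point y moves on the ℍ³-geodesic with direction η. Undoing this motion by a
hyperbolic rotation depending on h carries nearby slices to the slice through p, which has constant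
principal curvatures and hence an axis. Rotating back expresses the projection of y in y and η, with
coefficients depending on h alone. -/
theorem exists_axis_splitting {E : Type*} [NormedAddCommGroup E] [NormedSpace ℝ E]
    [FiniteDimensional ℝ E] (hE : Module.finrank ℝ E = 3) {y η : E → Fin 5 → ℝ} {h : E → ℝ}
    {U : Set E} (hU : IsOpen U) (hy : ContDiffOn ℝ ∞ y U) (hη : ContDiffOn ℝ ∞ η U)
    (hh : ContDiffOn ℝ ∞ h U) (hyy : ∀ u ∈ U, lorentz (y u) (y u) = -1)
    (hyη : ∀ u ∈ U, lorentz (y u) (η u) = 0) (hηη : ∀ u ∈ U, lorentz (η u) (η u) = 1)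
    (hy4 : ∀ u ∈ U, y u 4 = 0) (hη4 : ∀ u ∈ U, η u 4 = 0)
    (hinj : ∀ u ∈ U, ∀ X, fderiv ℝ y u X = 0 → fderiv ℝ h u X = 0 → X = 0)
    {τ : ℝ → ℝ} {V : Set ℝ} (hV : IsOpen V) (hτ : ContDiffOn ℝ ∞ τ V) (hhV : ∀ u ∈ U, h u ∈ V)
    {μ₂ μ₃ : ℝ → ℝ} (hμ : ∀ u ∈ U, μ₂ (h u) ≠ μ₃ (h u))
    (hframe : ∀ u ∈ U, ∃ T e₂ e₃, fderiv ℝ h u T ≠ 0 ∧ fderiv ℝ h u e₂ = 0 ∧ fderiv ℝ h u e₃ = 0 ∧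
      fderiv ℝ y u T = (τ (h u) * fderiv ℝ h u T) • η u ∧
      fderiv ℝ η u T = (τ (h u) * fderiv ℝ h u T) • y u ∧
      fderiv ℝ y u e₂ ≠ 0 ∧ fderiv ℝ y u e₃ ≠ 0 ∧
      fderiv ℝ η u e₂ = -μ₂ (h u) • fderiv ℝ y u e₂ ∧
      fderiv ℝ η u e₃ = -μ₃ (h u) • fderiv ℝ y u e₃) {p : E} (hp : p ∈ U) :
    ∃ Φ : (Fin 5 → ℝ) ≃ₗ[ℝ] (Fin 5 → ℝ), IsVerticalIsometry Φ ∧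
      ∃ (a b : ℝ → ℝ) (A : Set ℝ) (W : Set E), IsOpen A ∧ ContDiffOn ℝ ∞ a A ∧ ContDiffOn ℝ ∞ b A ∧
        (∀ t ∈ A, 1 < a t) ∧ IsOpen W ∧ p ∈ W ∧ W ⊆ U ∧
        ∀ u ∈ W, h u ∈ A ∧ axisProj Φ (y u) = a (h u) • y u + b (h u) • η u := by
  obtain ⟨ε, hε, hεV⟩ := Metric.isOpen_iff.1 hV (h p) (hhV p hp)
  obtain ⟨R, hR, hR0, hR'⟩ := exists_smooth_antideriv hε (hτ.mono hεV)
  set B := Metric.ball (h p) ε with hB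
  have hpB : h p ∈ B := Metric.mem_ball_self hε
  let U₁ := U ∩ h ⁻¹' B
  have hU₁ : IsOpen U₁ := hh.continuousOn.isOpen_inter_preimage hU Metric.isOpen_ball
  have hpU₁ : p ∈ U₁ := ⟨hp, hpB⟩
  let r : E → ℝ := fun u => R (h u)
  have hr : ContDiffOn ℝ ∞ r U₁ := hR.comp (hh.mono inter_subset_left) fun u hu => hu.2
  have hy₁ := hy.mono (inter_subset_left : U₁ ⊆ U)
  have hη₁ := hη.mono (inter_subset_left : U₁ ⊆ U)
  have hcosh : ContDiffOn ℝ ∞ (fun u => Real.cosh (r u)) U₁ := Real.contDiff_cosh.comp_contDiffOn hr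
  have hsinh : ContDiffOn ℝ ∞ (fun u => Real.sinh (r u)) U₁ := Real.contDiff_sinh.comp_contDiffOn hr
  -- Since r is an antiderivative of τ in the height, g and ξ are constant along T. Since R vanishes
  -- at h p, they equal y and η on the slice through p.
  let g : E → Fin 5 → ℝ := fun u => Real.cosh (r u) • y u - Real.sinh (r u) • η u
  let ξ : E → Fin 5 → ℝ := fun u => Real.cosh (r u) • η u - Real.sinh (r u) • y u
  have hg : ContDiffOn ℝ ∞ g U₁ := (hcosh.smul hy₁).sub (hsinh.smul hη₁)
  have hξ : ContDiffOn ℝ ∞ ξ U₁ := (hcosh.smul hη₁).sub (hsinh.smul hy₁)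
  have dr : ∀ u ∈ U₁, HasFDerivAt r (τ (h u) • fderiv ℝ h u) u := fun u hu =>
    (hR' (h u) hu.2).comp_hasFDerivAt u (hh.differentiableAt_of_isOpen hU hu.1).hasFDerivAt
  have dgen : ∀ {P Q : E → Fin 5 → ℝ} {u : E}, u ∈ U₁ → DifferentiableAt ℝ P u →
      DifferentiableAt ℝ Q u → ∀ X,
      fderiv ℝ (fun u => Real.cosh (r u) • P u - Real.sinh (r u) • Q u) u X =
        Real.cosh (r u) • fderiv ℝ P u X - Real.sinh (r u) • fderiv ℝ Q u X +
          (τ (h u) * fderiv ℝ h u X) • (Real.sinh (r u) • P u - Real.cosh (r u) • Q u) := by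
    intro P Q u hu hP hQ X
    have h1 := ((dr u hu).cosh.smul hP.hasFDerivAt).sub ((dr u hu).sinh.smul hQ.hasFDerivAt)
    change fderiv ℝ ((fun u => Real.cosh (r u)) • P - (fun u => Real.sinh (r u)) • Q) u X = _
    rw [HasFDerivAt.fderiv h1]
    simp only [sub_apply, add_apply,
      smul_apply, ContinuousLinearMap.smulRight_apply, smul_eq_mul]
    module
  have dy : ∀ u ∈ U₁, DifferentiableAt ℝ y u := fun u hu => hy.differentiableAt_of_isOpen hU hu.1
  have dη : ∀ u ∈ U₁, DifferentiableAt ℝ η u := fun u hu => hη.differentiableAt_of_isOpen hU hu.1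
  have dg : ∀ u ∈ U₁, ∀ X, fderiv ℝ g u X = _ := fun u hu X => dgen hu (dy u hu) (dη u hu) X
  have dξ : ∀ u ∈ U₁, ∀ X, fderiv ℝ ξ u X = _ := fun u hu X => dgen hu (dη u hu) (dy u hu) X
  have hT0 : ∀ u ∈ U₁, ∀ T, fderiv ℝ y u T = (τ (h u) * fderiv ℝ h u T) • η u →
      fderiv ℝ η u T = (τ (h u) * fderiv ℝ h u T) • y u → fderiv ℝ g u T = 0 ∧ fderiv ℝ ξ u T = 0 := by
    intro u hu T h1 h2
    rw [dg u hu, dξ u hu, h1, h2]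
    constructor <;> module
  obtain ⟨T, e₂, e₃, hT, he₂, he₃, hyT, hηT, hye₂, hye₃, hηe₂, hηe₃⟩ := hframe p hp
  set v₂ := fderiv ℝ y p e₂ with hv₂
  set v₃ := fderiv ℝ y p e₃ with hv₃
  have hrp : r p = 0 := hR0
  have hgp : ∀ u ∈ U₁, h u = h p → ∀ X, fderiv ℝ h u X = 0 → fderiv ℝ g u X = fderiv ℝ y u X ∧
      fderiv ℝ ξ u X = fderiv ℝ η u X := by
    intro u hu hup X hX
    have hru : r u = 0 := by simp only [r, hup, hR0]
    rw [dg u hu, dξ u hu, hX, hru]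
    simp
  -- Coordinates on the slice: ψ is constant along T, and its differential is injective on the span
  -- of e₂, e₃ because tangent vectors of ℍ³ are spacelike.
  let ψ : E → ℝ × ℝ := fun u => (lorentz (g u) v₂, lorentz (g u) v₃)
  have hψ : ContDiffOn ℝ ∞ ψ U₁ := (hg.lorentz contDiffOn_const).prodMk (hg.lorentz contDiffOn_const)
  have gd : ∀ u ∈ U₁, DifferentiableAt ℝ g u := fun u hu => hg.differentiableAt_of_isOpen hU₁ hu
  have dψ : ∀ u ∈ U₁, ∀ X, fderiv ℝ ψ u X = (lorentz (fderiv ℝ g u X) v₂, lorentz (fderiv ℝ g u X) v₃) := by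
    intro u hu X
    have hl : ∀ v : Fin 5 → ℝ, DifferentiableAt ℝ (fun u => lorentz (g u) v) u := fun v =>
      (gd u hu).lorentz (differentiableAt_const v)
    have h1 := (hl v₂).hasFDerivAt.prodMk (hl v₃).hasFDerivAt
    rw [HasFDerivAt.fderiv h1, ContinuousLinearMap.prod_apply,
      fderiv_lorentz (gd u hu) (differentiableAt_const v₂),
      fderiv_lorentz (gd u hu) (differentiableAt_const v₃)]
    simp
  have hyX : ∀ X, lorentz (fderiv ℝ y p X) (y p) = 0 := by
    intro X
    have := lorentz_fderiv_of_eventually_const (dy p hpU₁) (dy p hpU₁)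
      (by filter_upwards [hU.mem_nhds hp] with z hz using hyy z hz) X
    rw [lorentz_comm (y p)] at this
    linarith
  have hindep : ∀ a b : ℝ, a • v₂ + b • v₃ = 0 → a = 0 ∧ b = 0 := by
    intro a b hab
    have h1 : a • e₂ + b • e₃ = 0 := hinj p hp _ (by simpa using hab) (by simp [he₂, he₃])
    have h2 := congrArg (fderiv ℝ η p) h1
    simp only [map_add, map_smul, map_zero, hηe₂, hηe₃] at h2
    have h3 : ((μ₂ (h p) - μ₃ (h p)) * a) • v₂ = 0 := by
      have : ((μ₂ (h p) - μ₃ (h p)) * a) • v₂ = -(μ₃ (h p)) • (a • v₂ + b • v₃) -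
        (a • -μ₂ (h p) • v₂ + b • -μ₃ (h p) • v₃) := by module
      rw [this, hab, h2]; simp
    have ha : a = 0 := by
      rcases smul_eq_zero.1 h3 with h4 | h4
      · exact (mul_eq_zero.1 h4).resolve_left (sub_ne_zero.2 (hμ p hp))
      · exact absurd h4 hye₂
    refine ⟨ha, ?_⟩
    rw [ha, zero_smul, zero_add] at hab
    exact (smul_eq_zero.1 hab).resolve_right hye₃
  have hψsurj : ∀ s : ℝ × ℝ, ∃ a b : ℝ, fderiv ℝ ψ p (a • e₂ + b • e₃) = s := by
    let A : ℝ × ℝ →ₗ[ℝ] ℝ × ℝ := (fderiv ℝ ψ p).toLinearMap ∘ₗ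
      ((LinearMap.fst ℝ ℝ ℝ).smulRight e₂ + (LinearMap.snd ℝ ℝ ℝ).smulRight e₃)
    have hA : ∀ s, A s = fderiv ℝ ψ p (s.1 • e₂ + s.2 • e₃) := fun s => rfl
    have hAi : Function.Injective A := by
      rw [← LinearMap.ker_eq_bot, LinearMap.ker_eq_bot']
      intro s hs
      have hX : fderiv ℝ h p (s.1 • e₂ + s.2 • e₃) = 0 := by simp [he₂, he₃]
      rw [hA, dψ p hpU₁, (hgp p hpU₁ rfl _ hX).1] at hs
      have hsum : fderiv ℝ y p (s.1 • e₂ + s.2 • e₃) = s.1 • v₂ + s.2 • v₃ := by simp [hv₂, hv₃]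
      obtain ⟨h1, h2⟩ := Prod.mk.inj hs
      have h3 : fderiv ℝ y p (s.1 • e₂ + s.2 • e₃) = 0 := by
        by_contra hne
        have hpos := lorentz_self_pos_of_orthogonal (hyy p hp) (hyX _) hne
        nth_rewrite 2 [hsum] at hpos
        rw [lorentz_add_right, lorentz_smul_right, lorentz_smul_right, h1, h2] at hpos
        simp at hpos
      rw [hsum] at h3
      exact Prod.ext (hindep _ _ h3).1 (hindep _ _ h3).2
    intro s
    obtain ⟨t, ht⟩ := (LinearMap.injective_iff_surjective.1 hAi) s
    exact ⟨t.1, t.2, ht⟩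
  let Ψ : E → ℝ × (ℝ × ℝ) := fun u => (h u, ψ u)
  have hΨ : ContDiffOn ℝ ∞ Ψ U₁ := (hh.mono inter_subset_left).prodMk hψ
  have dΨ : ∀ u ∈ U₁, fderiv ℝ Ψ u = (fderiv ℝ h u).prod (fderiv ℝ ψ u) := fun u hu =>
    ((hh.differentiableAt_of_isOpen hU hu.1).hasFDerivAt.prodMk
      (hψ.differentiableAt_of_isOpen hU₁ hu).hasFDerivAt).fderiv
  have hΨsurj : Function.Surjective (fderiv ℝ Ψ p) := by
    rintro ⟨s, t⟩
    obtain ⟨a, b, hab⟩ := hψsurj t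
    refine ⟨(s / fderiv ℝ h p T) • T + (a • e₂ + b • e₃), ?_⟩
    have hψT : fderiv ℝ ψ p T = 0 := by
      rw [dψ p hpU₁, (hT0 p hpU₁ T hyT hηT).1]; simp
    rw [dΨ p hpU₁, ContinuousLinearMap.prod_apply, map_add (fderiv ℝ ψ p), hab]
    ext <;> simp [he₂, he₃, hψT, hT]
  have hΨbij : Function.Bijective (fderiv ℝ Ψ p) := by
    refine ⟨?_, hΨsurj⟩
    exact (LinearMap.injective_iff_surjective_of_finrank_eq_finrank
      (f := (fderiv ℝ Ψ p).toLinearMap) (by simp [hE])).2 hΨsurj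
  obtain ⟨e, he, hpe, heU, hebij, -, -⟩ := exists_openPartialHomeomorph_of_bijective_fderiv hU₁ hΨ hpU₁ hΨbij
  obtain ⟨V', W, f, hV', hW, hpW, hWe, hf, hfac⟩ := exists_factor_through_submersion
    (f := fun u => (g u, ξ u)) e.open_source (hψ.mono heU) ((hg.prodMk hξ).mono heU) hpe
    (fun t => by
      obtain ⟨X, hX⟩ := hΨsurj (0, t)
      refine ⟨X, ?_⟩
      rw [dΨ p hpU₁] at hX
      exact congrArg Prod.snd hX)
    (fun u hu X hX => by
      obtain ⟨T, -, -, hT, -, -, hyT, hηT, -⟩ := hframe u (heU hu).1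
      obtain ⟨gT, ξT⟩ := hT0 u (heU hu) T hyT hηT
      -- As (h, ψ) has bijective differential and dψ(T) = 0, the kernel of dψ is the line of T,
      -- where dg and dξ vanish.
      have h1 : X = (fderiv ℝ h u X / fderiv ℝ h u T) • T := by
        apply (hebij u hu).1
        rw [dΨ u (heU hu)]
        ext <;> simp [hX, hT, dψ u (heU hu) T, gT]
      have h2 : HasFDerivAt (fun u => (g u, ξ u)) _ u := (gd u (heU hu)).hasFDerivAt.prodMk
        (hξ.differentiableAt_of_isOpen hU₁ (heU hu)).hasFDerivAt
      rw [h2.fderiv, h1]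
      simp [gT, ξT])
  have himg : Ψ '' W ∈ 𝓝 (h p, ψ p) := by
    have hs := (hΨ.contDiffAt (hU₁.mem_nhds hpU₁)).hasStrictFDerivAt (by simp)
    rw [← hs.map_nhds_eq_of_surj (LinearMap.range_eq_top.2 hΨsurj)]
    exact image_mem_map (hW.mem_nhds hpW)
  obtain ⟨δ, hδ, hball⟩ := Metric.mem_nhds_iff.1 himg
  rw [← ball_prod_same] at hball
  set Ω := Metric.ball (ψ p) δ with hΩ
  have hslice : ∀ z ∈ Ω, ∃ u ∈ W, h u = h p ∧ ψ u = z := by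
    intro z hz
    obtain ⟨u, hu, huz⟩ := hball (show (h p, z) ∈ _ from ⟨Metric.mem_ball_self hδ, hz⟩)
    exact ⟨u, hu, (Prod.mk.inj huz).1, (Prod.mk.inj huz).2⟩
  have hΩV' : Ω ⊆ V' := by
    intro z hz
    obtain ⟨u, hu, -, rfl⟩ := hslice z hz
    exact (hfac u hu).1
  have hfg : ∀ u ∈ W, (f (ψ u)).1 = g u ∧ (f (ψ u)).2 = ξ u := fun u hu =>
    ⟨congrArg Prod.fst (hfac u hu).2.symm, congrArg Prod.snd (hfac u hu).2.symm⟩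
  have hf1 : ContDiffOn ℝ ∞ (fun z => (f z).1) V' := contDiff_fst.comp_contDiffOn hf
  have hf2 : ContDiffOn ℝ ∞ (fun z => (f z).2) V' := contDiff_snd.comp_contDiffOn hf
  have hchain : ∀ u ∈ W, ∀ X, fderiv ℝ (fun z => (f z).1) (ψ u) (fderiv ℝ ψ u X) = fderiv ℝ g u X ∧
      fderiv ℝ (fun z => (f z).2) (ψ u) (fderiv ℝ ψ u X) = fderiv ℝ ξ u X := by
    intro u hu X
    have h0 := (hψ.differentiableAt_of_isOpen hU₁ (heU (hWe hu))).hasFDerivAt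
    have h1 := (hf1.differentiableAt_of_isOpen hV' (hfac u hu).1).hasFDerivAt.comp u h0
    have h2 := (hf2.differentiableAt_of_isOpen hV' (hfac u hu).1).hasFDerivAt.comp u h0
    have h3 := h1.congr_of_eventuallyEq (f₁ := g)
      (by filter_upwards [hW.mem_nhds hu] with v hv using (hfg v hv).1.symm)
    have h4 := h2.congr_of_eventuallyEq (f₁ := ξ)
      (by filter_upwards [hW.mem_nhds hu] with v hv using (hfg v hv).2.symm)
    rw [h3.fderiv, h4.fderiv]
    exact ⟨rfl, rfl⟩
  have hgs : ∀ u ∈ W, h u = h p → (f (ψ u)).1 = y u ∧ (f (ψ u)).2 = η u := by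
    intro u hu hup
    have hru : r u = 0 := by simp only [r, hup, hR0]
    rw [(hfg u hu).1, (hfg u hu).2]
    simp [g, ξ, hru]
  have hWU : ∀ u ∈ W, u ∈ U := fun u hu => (heU (hWe hu)).1
  have hsurf : ∀ {l l' : ℝ}, l ≠ l' → (∀ u ∈ W, h u = h p → ∃ X X', fderiv ℝ h u X = 0 ∧
      fderiv ℝ h u X' = 0 ∧ fderiv ℝ y u X ≠ 0 ∧ fderiv ℝ y u X' ≠ 0 ∧
      fderiv ℝ η u X = -l • fderiv ℝ y u X ∧ fderiv ℝ η u X' = -l' • fderiv ℝ y u X') → _ :=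
    fun {l l'} hl hX => exists_axis_of_const_principal_curvatures (g := fun z => (f z).1)
      (ξ := fun z => (f z).2) (Ω := Ω) Metric.isOpen_ball (hf1.mono hΩV') (hf2.mono hΩV')
      (z₀ := ψ p) (Metric.mem_ball_self hδ)
      (fun z hz => by
        obtain ⟨u, hu, hup, rfl⟩ := hslice z hz
        rw [(hgs u hu hup).1, hyy u (hWU u hu)])
      (fun z hz => by
        obtain ⟨u, hu, hup, rfl⟩ := hslice z hz
        rw [(hgs u hu hup).1, (hgs u hu hup).2, hyη u (hWU u hu)])
      (fun z hz => by
        obtain ⟨u, hu, hup, rfl⟩ := hslice z hz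
        rw [(hgs u hu hup).2, hηη u (hWU u hu)])
      (fun z hz => by
        obtain ⟨u, hu, hup, rfl⟩ := hslice z hz
        rw [(hgs u hu hup).1, hy4 u (hWU u hu)])
      (fun z hz => by
        obtain ⟨u, hu, hup, rfl⟩ := hslice z hz
        rw [(hgs u hu hup).2, hη4 u (hWU u hu)])
      hl (fun z hz => by
        obtain ⟨u, hu, hup, rfl⟩ := hslice z hz
        obtain ⟨X, X', h1, h2, h3, h4, h5, h6⟩ := hX u hu hup
        refine ⟨fderiv ℝ ψ u X, fderiv ℝ ψ u X', ?_⟩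
        have hu₁ := heU (hWe hu)
        rw [(hchain u hu X).1, (hchain u hu X').1, (hchain u hu X).2, (hchain u hu X').2,
          (hgp u hu₁ hup X h1).1, (hgp u hu₁ hup X' h2).1, (hgp u hu₁ hup X h1).2,
          (hgp u hu₁ hup X' h2).2]
        exact ⟨h3, h4, h5, h6⟩)
  -- The curvatures are distinct with product 1, so one of them has square greater than 1. The
  -- surface result is applied in both orders and that curvature is named l'.
  obtain ⟨l, l', hll, hl', hne, Φ, hΦ, hnear⟩ : ∃ l l' : ℝ, l * l' = 1 ∧ 1 < l' ^ 2 ∧ l ≠ l' ∧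
      ∃ Φ : (Fin 5 → ℝ) ≃ₗ[ℝ] (Fin 5 → ℝ), IsVerticalIsometry Φ ∧
      ∀ᶠ z in 𝓝 (ψ p), axisProj Φ ((f z).2 + l • (f z).1) = 0 ∧
        axisProj Φ ((f z).2 + l' • (f z).1) = (f z).2 + l' • (f z).1 := by
    have hne := hμ p hp
    obtain ⟨s1, s2⟩ := hsurf hne (fun u hu hup => by
      obtain ⟨-, X, X', -, h1, h2, -, -, h3, h4, h5, h6⟩ := hframe u (hWU u hu)
      rw [hup] at h5 h6
      exact ⟨X, X', h1, h2, h3, h4, h5, h6⟩)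
    obtain ⟨t1, t2⟩ := hsurf hne.symm (fun u hu hup => by
      obtain ⟨-, X', X, -, h1, h2, -, -, h3, h4, h5, h6⟩ := hframe u (hWU u hu)
      rw [hup] at h5 h6
      exact ⟨X, X', h2, h1, h4, h3, h6, h5⟩)
    by_cases h3 : 1 < μ₃ (h p) ^ 2
    · exact ⟨_, _, s1, h3, hne, s2 h3⟩
    · have h2 : 1 < μ₂ (h p) ^ 2 := by
        by_contra h2
        apply hne
        nlinarith [sq_nonneg (μ₂ (h p) - μ₃ (h p))]
      exact ⟨_, _, t1, h2, hne.symm, t2 h2⟩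
  have hd : l' - l ≠ 0 := sub_ne_zero.2 hne.symm
  -- Write y = cosh r · g + sinh r · ξ in terms of ξ + l g and ξ + l' g. The projection keeps only
  -- the second term, which is then expanded back in y and η.
  let a : ℝ → ℝ := fun t => (Real.cosh (R t) - l * Real.sinh (R t)) *
    (l' * Real.cosh (R t) - Real.sinh (R t)) / (l' - l)
  let b : ℝ → ℝ := fun t => (Real.cosh (R t) - l * Real.sinh (R t)) *
    (Real.cosh (R t) - l' * Real.sinh (R t)) / (l' - l)
  have hcR : ContDiffOn ℝ ∞ (fun t => Real.cosh (R t)) B := Real.contDiff_cosh.comp_contDiffOn hR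
  have hsR : ContDiffOn ℝ ∞ (fun t => Real.sinh (R t)) B := Real.contDiff_sinh.comp_contDiffOn hR
  have ha : ContDiffOn ℝ ∞ a B := ((hcR.sub (contDiffOn_const.mul hsR)).mul
    ((contDiffOn_const.mul hcR).sub hsR)).div_const _
  have hb : ContDiffOn ℝ ∞ b B := ((hcR.sub (contDiffOn_const.mul hsR)).mul
    (hcR.sub (contDiffOn_const.mul hsR))).div_const _
  have hap : 1 < a (h p) := by
    have h1 : a (h p) = l' ^ 2 / (l' ^ 2 - 1) := by
      have h2 : l' ^ 2 - 1 ≠ 0 := by linarith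
      simp only [a, hR0, Real.cosh_zero, Real.sinh_zero]
      rw [div_eq_div_iff hd h2]
      linear_combination l' * hll
    rw [h1, lt_div_iff₀ (by linarith)]
    linarith
  let A := B ∩ a ⁻¹' Ioi 1
  have hA : IsOpen A := ha.continuousOn.isOpen_inter_preimage Metric.isOpen_ball isOpen_Ioi
  obtain ⟨Ω', hΩ'sub, hΩ', hpΩ'⟩ := mem_nhds_iff.1 hnear
  let W' := W ∩ ((U₁ ∩ h ⁻¹' A) ∩ (U₁ ∩ ψ ⁻¹' Ω'))
  refine ⟨Φ, hΦ, a, b, A, W', hA, ha.mono inter_subset_left, hb.mono inter_subset_left,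
    fun t ht => ht.2, ?_, ⟨hpW, ⟨hpU₁, hpB, hap⟩, hpU₁, hpΩ'⟩, fun u hu => hWU u hu.1, ?_⟩
  · exact hW.inter (((hh.mono inter_subset_left).continuousOn.isOpen_inter_preimage hU₁ hA).inter
      (hψ.continuousOn.isOpen_inter_preimage hU₁ hΩ'))
  · intro u hu
    refine ⟨hu.2.1.2, ?_⟩
    obtain ⟨pF, pG⟩ := hΩ'sub hu.2.2.2
    rw [(hfg u hu.1).1, (hfg u hu.1).2] at pF pG
    have hcs := Real.cosh_sq (r u)
    have e1 : y u = ((l' * Real.sinh (r u) - Real.cosh (r u)) / (l' - l)) • (ξ u + l • g u) +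
        ((Real.cosh (r u) - l * Real.sinh (r u)) / (l' - l)) • (ξ u + l' • g u) := by
      ext i
      simp only [g, ξ, Pi.add_apply, Pi.smul_apply, Pi.sub_apply, smul_eq_mul]
      field_simp
      linear_combination (l - l') * y u i * hcs
    conv_lhs => rw [e1]
    rw [map_add, map_smul, map_smul, pF, pG, smul_zero, zero_add]
    ext i
    simp only [a, b, g, ξ, r, Pi.add_apply, Pi.smul_apply, Pi.sub_apply, smul_eq_mul]
    field_simp
    ring

end Splitting

/-! ### Horizontal parts of vectors. -/

section Horizontal

theorem normalH3R_eq (u : Fin 5 → ℝ) : normalH3R u = u - u 4 • verticalField := by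
  ext i; fin_cases i <;> simp [normalH3R, verticalField]

theorem normalH3R_four (u : Fin 5 → ℝ) : normalH3R u 4 = 0 := by simp [normalH3R]

theorem lorentz_normalH3R_right (u v : Fin 5 → ℝ) :
    lorentz u (normalH3R v) = lorentz u v - u 4 * v 4 := by
  simp [lorentz, normalH3R]

theorem lorentz_normalH3R_left (u v : Fin 5 → ℝ) :
    lorentz (normalH3R u) v = lorentz u v - u 4 * v 4 := by
  simp [lorentz, normalH3R]

/-- The horizontal projection as a continuous linear map. -/
noncomputable def horizontalL : (Fin 5 → ℝ) →L[ℝ] (Fin 5 → ℝ) :=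
  ContinuousLinearMap.id ℝ _ -
    (ContinuousLinearMap.proj (R := ℝ) (φ := fun _ : Fin 5 => ℝ) 4).smulRight verticalField

theorem horizontalL_apply (u : Fin 5 → ℝ) : horizontalL u = normalH3R u := by
  rw [normalH3R_eq]
  simp [horizontalL]

theorem normalH3R_smul (a : ℝ) (u : Fin 5 → ℝ) : normalH3R (a • u) = a • normalH3R u := by
  rw [← horizontalL_apply, map_smul, horizontalL_apply]

theorem normalH3R_sub (u v : Fin 5 → ℝ) : normalH3R (u - v) = normalH3R u - normalH3R v := by
  simp only [← horizontalL_apply, map_sub]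

theorem normalH3R_normalH3R (u : Fin 5 → ℝ) : normalH3R (normalH3R u) = normalH3R u := by
  simp [normalH3R]

theorem normalH3R_of_four_eq_zero {u : Fin 5 → ℝ} (h : u 4 = 0) : normalH3R u = u := by
  rw [normalH3R_eq, h, zero_smul, sub_zero]

theorem normalH3R_verticalField : normalH3R verticalField = 0 := by
  ext i; fin_cases i <;> simp [normalH3R, verticalField]

theorem lorentz_normalH3R_self {p : Fin 5 → ℝ} (hp : p ∈ H3R) :
    lorentz (normalH3R p) (normalH3R p) = -1 := by
  rw [lorentz_normalH3R_right, lorentz_normalH3R_left, normalH3R_four, ← (mem_H3R_iff.1 hp).1]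
  ring

theorem IsVerticalIsometry.axisProj_normalH3R {Φ : (Fin 5 → ℝ) ≃ₗ[ℝ] (Fin 5 → ℝ)}
    (hΦ : IsVerticalIsometry Φ) (u : Fin 5 → ℝ) : axisProj Φ (normalH3R u) = axisProj Φ u := by
  rw [normalH3R_eq, map_sub, map_smul, hΦ.axisProj_vertical, smul_zero, sub_zero]

/-- The projection is idempotent and self-adjoint for the Minkowski product. -/
theorem IsVerticalIsometry.lorentz_axisProj_self {Φ : (Fin 5 → ℝ) ≃ₗ[ℝ] (Fin 5 → ℝ)}
    (hΦ : IsVerticalIsometry Φ) (u : Fin 5 → ℝ) :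
    lorentz (axisProj Φ u) (axisProj Φ u) = lorentz (axisProj Φ u) u := by
  rw [hΦ.lorentz_axisProj, axisProj_apply, hΦ.toIsLinearIsometryH3R.isometry]
  simp [lorentz, stdAxisProj]; ring

end Horizontal

/-! ### Structure equations of a class 𝒜 hypersurface. -/

section LocalHypersurface

variable {E : Type*} [NormedAddCommGroup E] [NormedSpace ℝ E]

/-- A hypersurface of `ℍ³ × ℝ` parametrized by an open set, with unit normal `N` and principal
curvatures `k₁, k₂, k₃`, the first one in the direction of the vertical field. -/
structure IsLocalHypersurface (x N : E → Fin 5 → ℝ) (U : Set E) (k₁ k₂ k₃ : E → ℝ) : Prop where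
  isOpen : IsOpen U
  smooth : ContDiffOn ℝ ∞ x U
  smooth_normal : ContDiffOn ℝ ∞ N U
  mem : ∀ u ∈ U, x u ∈ H3R
  injective : ∀ u ∈ U, ∀ X, fderiv ℝ x u X = 0 → X = 0
  unit : ∀ u ∈ U, lorentz (N u) (N u) = 1
  tangent : ∀ u ∈ U, lorentz (N u) (normalH3R (x u)) = 0
  orthogonal : ∀ u ∈ U, ∀ X, lorentz (N u) (fderiv ℝ x u X) = 0
  frame : ∀ u ∈ U, ∃ (T e₂ e₃ : E) (σ : ℝ), T ≠ 0 ∧ e₂ ≠ 0 ∧ e₃ ≠ 0 ∧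
    verticalField = fderiv ℝ x u T + σ • N u ∧
    projH3R (x u) (fderiv ℝ N u T) = -k₁ u • fderiv ℝ x u T ∧
    projH3R (x u) (fderiv ℝ N u e₂) = -k₂ u • fderiv ℝ x u e₂ ∧
    projH3R (x u) (fderiv ℝ N u e₃) = -k₃ u • fderiv ℝ x u e₃
  distinct : ∀ u ∈ U, k₁ u ≠ k₂ u ∧ k₁ u ≠ k₃ u ∧ k₂ u ≠ k₃ u

namespace IsLocalHypersurface

variable {x N : E → Fin 5 → ℝ} {U : Set E} {k₁ k₂ k₃ : E → ℝ}

theorem differentiableAt (H : IsLocalHypersurface x N U k₁ k₂ k₃) {u : E} (hu : u ∈ U) :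
    DifferentiableAt ℝ x u := H.smooth.differentiableAt_of_isOpen H.isOpen hu

theorem differentiableAt_normal (H : IsLocalHypersurface x N U k₁ k₂ k₃) {u : E} (hu : u ∈ U) :
    DifferentiableAt ℝ N u := H.smooth_normal.differentiableAt_of_isOpen H.isOpen hu

theorem hasFDerivAt_normalH3R {f : E → Fin 5 → ℝ} {u : E} (hf : DifferentiableAt ℝ f u) :
    HasFDerivAt (fun u => normalH3R (f u)) (horizontalL.comp (fderiv ℝ f u)) u := by
  simp only [← horizontalL_apply]
  exact horizontalL.hasFDerivAt.comp u hf.hasFDerivAt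

theorem fderiv_normalH3R {f : E → Fin 5 → ℝ} {u : E} (hf : DifferentiableAt ℝ f u) (X : E) :
    fderiv ℝ (fun u => normalH3R (f u)) u X = normalH3R (fderiv ℝ f u X) := by
  rw [(hasFDerivAt_normalH3R hf).fderiv, ContinuousLinearMap.comp_apply, horizontalL_apply]

/-- The position vector is normal to the tangent vectors of the hypersurface. -/
theorem lorentz_fderiv_position (H : IsLocalHypersurface x N U k₁ k₂ k₃) {u : E} (hu : u ∈ U)
    (X : E) : lorentz (fderiv ℝ x u X) (normalH3R (x u)) = 0 := by
  have hd := (hasFDerivAt_normalH3R (H.differentiableAt hu)).differentiableAt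
  have h := lorentz_fderiv_of_eventually_const hd hd
    (by filter_upwards [H.isOpen.mem_nhds hu] with v hv using lorentz_normalH3R_self (H.mem v hv)) X
  rw [fderiv_normalH3R (H.differentiableAt hu), lorentz_comm (normalH3R (x u))] at h
  have h1 : lorentz (normalH3R (fderiv ℝ x u X)) (normalH3R (x u)) =
      lorentz (fderiv ℝ x u X) (normalH3R (x u)) := by
    rw [lorentz_normalH3R_left, normalH3R_four]; ring
  rw [h1] at h
  linarith

/-- The second fundamental form is symmetric. -/
theorem lorentz_fderiv_normal_symm (H : IsLocalHypersurface x N U k₁ k₂ k₃) {u : E} (hu : u ∈ U)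
    (X Z : E) : lorentz (fderiv ℝ N u Z) (fderiv ℝ x u X) =
      lorentz (fderiv ℝ N u X) (fderiv ℝ x u Z) := by
  have hdd : DifferentiableAt ℝ (fderiv ℝ x) u :=
    (H.smooth.fderiv_of_isOpen H.isOpen (m := ∞) le_rfl).differentiableAt_of_isOpen H.isOpen hu
  have key : ∀ X Z, lorentz (N u) (fderiv ℝ (fderiv ℝ x) u Z X) +
      lorentz (fderiv ℝ N u Z) (fderiv ℝ x u X) = 0 := by
    intro X Z
    have h1 : HasFDerivAt (fun v => fderiv ℝ x v X) _ u :=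
      hdd.hasFDerivAt.clm_apply (hasFDerivAt_const X u)
    have h := lorentz_fderiv_of_eventually_const (H.differentiableAt_normal hu) h1.differentiableAt
      (by filter_upwards [H.isOpen.mem_nhds hu] with v hv using H.orthogonal v hv X) Z
    rw [h1.fderiv] at h
    simpa using h
  have hs : IsSymmSndFDerivAt ℝ x u :=
    (H.smooth.contDiffAt (H.isOpen.mem_nhds hu)).isSymmSndFDerivAt (by
      rw [minSmoothness_of_isRCLikeNormedField]
      exact WithTop.coe_le_coe.2 (le_top : (2 : ℕ∞) ≤ ⊤))
  have h1 := key X Z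
  have h2 := key Z X
  rw [hs.eq X Z] at h2
  linarith

theorem fderiv_normal_eq {k : ℝ} {u X : E}
    (h : projH3R (x u) (fderiv ℝ N u X) = -k • fderiv ℝ x u X) :
    fderiv ℝ N u X = -k • fderiv ℝ x u X -
      lorentz (fderiv ℝ N u X) (normalH3R (x u)) • normalH3R (x u) := by
  rw [← h, projH3R, add_sub_cancel_right]

theorem lorentz_fderiv_normal (H : IsLocalHypersurface x N U k₁ k₂ k₃) {u : E} (hu : u ∈ U)
    {k : ℝ} {X : E} (h : projH3R (x u) (fderiv ℝ N u X) = -k • fderiv ℝ x u X) (Z : E) :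
    lorentz (fderiv ℝ N u X) (fderiv ℝ x u Z) = -k * lorentz (fderiv ℝ x u X) (fderiv ℝ x u Z) := by
  rw [fderiv_normal_eq h, lorentz_sub_left, lorentz_smul_left, lorentz_smul_left,
    lorentz_comm (normalH3R (x u)), H.lorentz_fderiv_position hu]
  ring

/-- Differentiating ⟨N, y⟩ = 0 leaves only the vertical coordinates, because N is orthogonal to
dx(X). This is the correction between the flat and the Levi-Civita derivative of N. -/
theorem lorentz_fderiv_normal_position (H : IsLocalHypersurface x N U k₁ k₂ k₃) {u : E}
    (hu : u ∈ U) (X : E) : lorentz (fderiv ℝ N u X) (normalH3R (x u)) = N u 4 * fderiv ℝ x u X 4 := by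
  have hd := (hasFDerivAt_normalH3R (H.differentiableAt hu)).differentiableAt
  have h := lorentz_fderiv_of_eventually_const (H.differentiableAt_normal hu) hd
    (by filter_upwards [H.isOpen.mem_nhds hu] with v hv using H.tangent v hv) X
  rw [fderiv_normalH3R (H.differentiableAt hu), lorentz_normalH3R_right, H.orthogonal u hu] at h
  linarith

/-- Along horizontal principal directions the normal field differentiates to a multiple of the
position differential. -/
theorem fderiv_normal_of_horizontal (H : IsLocalHypersurface x N U k₁ k₂ k₃) {u : E} (hu : u ∈ U)
    {k : ℝ} {X : E} (h : projH3R (x u) (fderiv ℝ N u X) = -k • fderiv ℝ x u X)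
    (hX : fderiv ℝ x u X 4 = 0) : fderiv ℝ N u X = -k • fderiv ℝ x u X := by
  rw [fderiv_normal_eq h, H.lorentz_fderiv_normal_position hu, hX, mul_zero, zero_smul, sub_zero]

theorem lorentz_fderiv_normal_self (H : IsLocalHypersurface x N U k₁ k₂ k₃) {u : E} (hu : u ∈ U)
    (X : E) : lorentz (fderiv ℝ N u X) (N u) = 0 := by
  have hd := H.differentiableAt_normal hu
  have h := lorentz_fderiv_of_eventually_const hd hd
    (by filter_upwards [H.isOpen.mem_nhds hu] with v hv using H.unit v hv) X
  rw [lorentz_comm (N u)] at h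
  linarith

/-- The structure equations of a hypersurface for which the vertical tangent part is principal. -/
theorem structure_equations (H : IsLocalHypersurface x N U k₁ k₂ k₃) {u : E} (hu : u ∈ U) :
    N u 4 ^ 2 < 1 ∧ (∀ X, fderiv ℝ N u X 4 = -k₁ u * fderiv ℝ x u X 4) ∧
    (∀ X k, projH3R (x u) (fderiv ℝ N u X) = -k • fderiv ℝ x u X → k ≠ k₁ u →
      fderiv ℝ x u X 4 = 0 ∧ fderiv ℝ N u X = -k • fderiv ℝ x u X) ∧
    ∃ T e₂ e₃, fderiv ℝ x u T 4 = 1 - N u 4 ^ 2 ∧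
      normalH3R (fderiv ℝ x u T) = -N u 4 • normalH3R (N u) ∧
      normalH3R (fderiv ℝ N u T) = (k₁ u * N u 4) • normalH3R (N u) -
        (N u 4 * (1 - N u 4 ^ 2)) • normalH3R (x u) ∧
      e₂ ≠ 0 ∧ e₃ ≠ 0 ∧ fderiv ℝ x u e₂ 4 = 0 ∧ fderiv ℝ x u e₃ 4 = 0 ∧
      fderiv ℝ N u e₂ = -k₂ u • fderiv ℝ x u e₂ ∧ fderiv ℝ N u e₃ = -k₃ u • fderiv ℝ x u e₃ := by
  obtain ⟨T, e₂, e₃, σ, hT, he₂, he₃, hv, wT, w₂, w₃⟩ := H.frame u hu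
  have hσ : N u 4 = σ := by
    rw [← lorentz_verticalField (N u), hv, lorentz_add_right, lorentz_smul_right, H.orthogonal u hu,
      H.unit u hu]
    ring
  have hh : ∀ X, fderiv ℝ x u X 4 = lorentz (fderiv ℝ x u X) (fderiv ℝ x u T) := by
    intro X
    rw [← lorentz_verticalField (fderiv ℝ x u X), hv, lorentz_add_right, lorentz_smul_right,
      lorentz_comm _ (N u), H.orthogonal u hu, mul_zero, add_zero]
  have hT4 : fderiv ℝ x u T 4 = 1 - N u 4 ^ 2 := by
    have h := congrArg (fun v : Fin 5 → ℝ => v 4) hv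
    simp only [Pi.add_apply, Pi.smul_apply, smul_eq_mul] at h
    have h1 : verticalField 4 = 1 := by simp [verticalField]
    rw [h1, ← hσ] at h
    linarith
  have hpos : 0 < lorentz (fderiv ℝ x u T) (fderiv ℝ x u T) :=
    lorentz_self_pos_of_orthogonal (lorentz_normalH3R_self (H.mem u hu))
      (H.lorentz_fderiv_position hu T) fun h => hT (H.injective u hu T h)
  rw [← hh, hT4] at hpos
  -- The vertical vector is dx(T) + σN and dN(X) ⊥ N, so by symmetry of the second fundamental form
  -- T may be moved into dN, where it is principal.
  have hN4 : ∀ X, fderiv ℝ N u X 4 = -k₁ u * fderiv ℝ x u X 4 := by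
    intro X
    rw [← lorentz_verticalField (fderiv ℝ N u X), hv, lorentz_add_right, lorentz_smul_right,
      H.lorentz_fderiv_normal_self hu, H.lorentz_fderiv_normal_symm hu,
      H.lorentz_fderiv_normal hu wT, hh X, lorentz_comm (fderiv ℝ x u T)]
    ring
  -- Eigenvectors for different principal curvatures are orthogonal, and orthogonality to T means
  -- being horizontal.
  have hhor : ∀ X k, projH3R (x u) (fderiv ℝ N u X) = -k • fderiv ℝ x u X → k ≠ k₁ u →
      fderiv ℝ x u X 4 = 0 ∧ fderiv ℝ N u X = -k • fderiv ℝ x u X := by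
    intro X k hX hk
    have h1 := H.lorentz_fderiv_normal hu hX T
    rw [H.lorentz_fderiv_normal_symm hu, H.lorentz_fderiv_normal hu wT,
      lorentz_comm (fderiv ℝ x u T), ← hh] at h1
    have h2 : fderiv ℝ x u X 4 = 0 := by
      have : (k - k₁ u) * fderiv ℝ x u X 4 = 0 := by linarith
      exact (mul_eq_zero.1 this).resolve_left (sub_ne_zero.2 hk)
    exact ⟨h2, H.fderiv_normal_of_horizontal hu hX h2⟩
  obtain ⟨d₂, d₃, -⟩ := H.distinct u hu
  have hnT : normalH3R (fderiv ℝ x u T) = -N u 4 • normalH3R (N u) := by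
    have h : fderiv ℝ x u T = verticalField - σ • N u := by rw [hv, add_sub_cancel_right]
    rw [h, normalH3R_sub, normalH3R_verticalField, normalH3R_smul, hσ]
    module
  refine ⟨by linarith, hN4, hhor, T, e₂, e₃, hT4, hnT, ?_, he₂, he₃, (hhor _ _ w₂ d₂.symm).1,
    (hhor _ _ w₃ d₃.symm).1, (hhor _ _ w₂ d₂.symm).2, (hhor _ _ w₃ d₃.symm).2⟩
  rw [fderiv_normal_eq wT, normalH3R_sub, normalH3R_smul, normalH3R_smul, hnT,
    H.lorentz_fderiv_normal_position hu, normalH3R_normalH3R, hT4]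
  module

end IsLocalHypersurface

end LocalHypersurface

/-! ### The axis of a hypersurface near a point. -/

section LocalSplitting

theorem hasDerivAt_inv_sqrt_one_sub_sq {s : ℝ} (hs : s ^ 2 < 1) :
    HasDerivAt (fun s : ℝ => (√(1 - s ^ 2))⁻¹) (s / √(1 - s ^ 2) ^ 3) s := by
  have hpos : 0 < 1 - s ^ 2 := by linarith
  have hne : √(1 - s ^ 2) ≠ 0 := (Real.sqrt_pos.2 hpos).ne'
  have h1 : HasDerivAt (fun s : ℝ => 1 - s ^ 2) (-(2 * s)) s := by
    simpa using (hasDerivAt_pow 2 s).const_sub 1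
  refine ((h1.sqrt hpos.ne').inv hne).congr_deriv ?_
  field_simp

variable {E : Type*} [NormedAddCommGroup E] [NormedSpace ℝ E]

theorem hasFDerivAt_coord {f : E → Fin 5 → ℝ} {u : E} (hf : DifferentiableAt ℝ f u) (i : Fin 5) :
    HasFDerivAt (fun u => f u i)
      ((ContinuousLinearMap.proj (R := ℝ) (φ := fun _ : Fin 5 => ℝ) i).comp (fderiv ℝ f u)) u :=
  (ContinuousLinearMap.proj (R := ℝ) (φ := fun _ : Fin 5 => ℝ) i).hasFDerivAt.comp u hf.hasFDerivAt

theorem fderiv_coord {f : E → Fin 5 → ℝ} {u : E} (hf : DifferentiableAt ℝ f u) (i : Fin 5) (X : E) :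
    fderiv ℝ (fun u => f u i) u X = fderiv ℝ f u X i := by
  rw [(hasFDerivAt_coord hf i).fderiv]; rfl

theorem ContDiffOn.coord {f : E → Fin 5 → ℝ} {U : Set E} {n : WithTop ℕ∞} (hf : ContDiffOn ℝ n f U)
    (i : Fin 5) : ContDiffOn ℝ n (fun u => f u i) U :=
  contDiffOn_pi.1 hf i

theorem ContDiffOn.normalH3R {f : E → Fin 5 → ℝ} {U : Set E} {n : WithTop ℕ∞}
    (hf : ContDiffOn ℝ n f U) : ContDiffOn ℝ n (fun u => normalH3R (f u)) U := by
  simp only [← horizontalL_apply]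
  exact horizontalL.contDiff.comp_contDiffOn hf

/-- With σ, k₂ and k₃ functions of the height, `exists_axis_splitting` applies to y and the
normalized n. The last clause comes from differentiating the splitting along horizontal principal
directions, where the coefficients are constant; it is kept because it determines the projection
pointwise. -/
theorem IsLocalHypersurface.exists_splitting [FiniteDimensional ℝ E] (hE : Module.finrank ℝ E = 3)
    {x N : E → Fin 5 → ℝ} {U : Set E} {k₁ k₂ k₃ : E → ℝ}
    (H : IsLocalHypersurface x N U k₁ k₂ k₃) {f₁ f₂ : ℝ → ℝ}
    (hrel : ∀ u ∈ U, k₂ u = f₁ (k₁ u) ∧ k₃ u = f₂ (k₁ u)) {p : E} (hp : p ∈ U) :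
    ∃ Φ : (Fin 5 → ℝ) ≃ₗ[ℝ] (Fin 5 → ℝ), IsVerticalIsometry Φ ∧
      ∃ (a b : ℝ → ℝ) (A : Set ℝ) (W : Set E), IsOpen A ∧ ContDiffOn ℝ ∞ a A ∧ (∀ t ∈ A, 1 < a t) ∧
        IsOpen W ∧ p ∈ W ∧ W ⊆ U ∧ ∀ u ∈ W, x u 4 ∈ A ∧ b (x u 4) ≠ 0 ∧
          axisProj Φ (x u) = a (x u 4) • normalH3R (x u) + b (x u 4) • normalH3R (N u) ∧
          ∀ X k, projH3R (x u) (fderiv ℝ N u X) = -k • fderiv ℝ x u X → k ≠ k₁ u →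
            axisProj Φ (fderiv ℝ x u X) = (a (x u 4) - b (x u 4) * k) • fderiv ℝ x u X := by
  have hdh : ∀ u ∈ U, ∀ X, fderiv ℝ (fun u => x u 4) u X = fderiv ℝ x u X 4 := fun u hu X =>
    fderiv_coord (H.differentiableAt hu) 4 X
  have hdσ : ∀ u ∈ U, ∀ X, fderiv ℝ (fun u => N u 4) u X = fderiv ℝ N u X 4 := fun u hu X =>
    fderiv_coord (H.differentiableAt_normal hu) 4 X
  have hh := H.smooth.coord 4
  have hσ := H.smooth_normal.coord 4
  obtain ⟨V, W, s, hV, hW, hpW, hWU, hs, hfac⟩ := exists_factor_through_submersion H.isOpen hh hσ hp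
    (by
      obtain ⟨hN, -, -, T, -, -, hT, -⟩ := H.structure_equations hp
      intro c
      refine ⟨(c / (1 - N p 4 ^ 2)) • T, ?_⟩
      rw [map_smul, hdh p hp, hT, smul_eq_mul, div_mul_cancel₀]
      linarith)
    (fun u hu X hX => by
      rw [hdσ u hu, (H.structure_equations hu).2.1, ← hdh u hu, hX, mul_zero])
  let V₁ := V ∩ (fun t => s t ^ 2) ⁻¹' Iio 1
  have hV₁ : IsOpen V₁ := (hs.pow 2).continuousOn.isOpen_inter_preimage hV isOpen_Iio
  have hWV₁ : ∀ u ∈ W, x u 4 ∈ V₁ := fun u hu => ⟨(hfac u hu).1, by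
    rw [mem_preimage, ← (hfac u hu).2]
    exact (H.structure_equations (hWU hu)).1⟩
  have hρ : ContDiffOn ℝ ∞ (fun t => (√(1 - s t ^ 2))⁻¹) V₁ := by
    have h1 : ContDiffOn ℝ ∞ (fun t => 1 - s t ^ 2) V₁ :=
      contDiffOn_const.sub ((hs.mono inter_subset_left).pow 2)
    have h2 : ∀ t ∈ V₁, 0 < 1 - s t ^ 2 := fun t ht => sub_pos.2 ht.2
    exact (h1.sqrt fun t ht => (h2 t ht).ne').inv fun t ht => (Real.sqrt_pos.2 (h2 t ht)).ne'
  have hk : ∀ u ∈ W, k₁ u = -deriv s (x u 4) := by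
    intro u hu
    obtain ⟨hN, h1, -, T, -, -, hT, -⟩ := H.structure_equations (hWU hu)
    have h2 : HasFDerivAt (fun u => s (x u 4)) (deriv s (x u 4) • fderiv ℝ (fun u => x u 4) u) u :=
      (hs.differentiableAt_of_isOpen hV (hfac u hu).1).hasDerivAt.comp_hasFDerivAt u
        (hasFDerivAt_coord (H.differentiableAt (hWU hu)) 4).differentiableAt.hasFDerivAt
    have h3 := (h2.congr_of_eventuallyEq (f₁ := fun u => N u 4)
      (by filter_upwards [hW.mem_nhds hu] with v hv using (hfac v hv).2)).fderiv
    have h4 := congrArg (fun L : E →L[ℝ] ℝ => L T) h3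
    simp only [smul_apply, hdσ u (hWU hu), hdh u (hWU hu), h1, hT, smul_eq_mul] at h4
    have h5 : 1 - N u 4 ^ 2 ≠ 0 := by linarith
    have := mul_right_cancel₀ h5 h4
    linarith
  let η : E → Fin 5 → ℝ := fun u => (√(1 - N u 4 ^ 2))⁻¹ • normalH3R (N u)
  have hηs : ∀ u ∈ W, η u = (√(1 - s (x u 4) ^ 2))⁻¹ • normalH3R (N u) := fun u hu => by
    simp only [η, (hfac u hu).2]
  have hhW := hh.mono hWU
  have hη : ContDiffOn ℝ ∞ η W :=
    ((hρ.comp hhW hWV₁).smul (H.smooth_normal.mono hWU).normalH3R).congr hηs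
  have hpos : ∀ u ∈ W, 0 < 1 - N u 4 ^ 2 := fun u hu =>
    sub_pos.2 (H.structure_equations (hWU hu)).1
  have hsq : ∀ u ∈ W, √(1 - N u 4 ^ 2) ^ 2 = 1 - N u 4 ^ 2 := fun u hu => Real.sq_sqrt (hpos u hu).le
  have hsq0 : ∀ u ∈ W, √(1 - N u 4 ^ 2) ≠ 0 := fun u hu => (Real.sqrt_pos.2 (hpos u hu)).ne'
  have dη : ∀ u ∈ W, ∀ X, fderiv ℝ η u X = (√(1 - N u 4 ^ 2))⁻¹ • normalH3R (fderiv ℝ N u X) +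
      (N u 4 / √(1 - N u 4 ^ 2) ^ 3 * fderiv ℝ N u X 4) • normalH3R (N u) := by
    intro u hu X
    have h1 := (hasDerivAt_inv_sqrt_one_sub_sq (H.structure_equations (hWU hu)).1).comp_hasFDerivAt u
      (hasFDerivAt_coord (H.differentiableAt_normal (hWU hu)) 4)
    have h2 := h1.smul (IsLocalHypersurface.hasFDerivAt_normalH3R (H.differentiableAt_normal (hWU hu)))
    have h3 : HasFDerivAt η _ u := h2
    rw [h3.fderiv]
    simp [horizontalL_apply]
  have hnn : ∀ u ∈ W, lorentz (normalH3R (N u)) (normalH3R (N u)) = 1 - N u 4 ^ 2 := by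
    intro u hu
    rw [lorentz_normalH3R_right, lorentz_normalH3R_left, normalH3R_four, H.unit u (hWU hu)]
    ring
  have hyn : ∀ u ∈ W, lorentz (normalH3R (x u)) (normalH3R (N u)) = 0 := by
    intro u hu
    rw [lorentz_normalH3R_right, normalH3R_four, lorentz_comm, H.tangent u (hWU hu)]
    ring
  have dy : ∀ u ∈ W, ∀ X, fderiv ℝ (fun u => normalH3R (x u)) u X = normalH3R (fderiv ℝ x u X) :=
    fun u hu X => IsLocalHypersurface.fderiv_normalH3R (H.differentiableAt (hWU hu)) X
  obtain ⟨Φ, hΦ, a, b, A, W', hA, ha, hb, ha1, hW', hpW', hW'W, hsplit⟩ :=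
    exists_axis_splitting hE hW (H.smooth.mono hWU).normalH3R hη hhW
      (fun u hu => lorentz_normalH3R_self (H.mem u (hWU hu)))
      (fun u hu => by simp only [η, lorentz_smul_right, hyn u hu, mul_zero])
      (fun u hu => by
        have h0 := hsq0 u hu
        have hr := hsq u hu
        simp only [η, lorentz_smul_left, lorentz_smul_right, hnn u hu]
        generalize √(1 - N u 4 ^ 2) = c at h0 hr ⊢
        rw [← hr]
        field_simp)
      (fun u _ => normalH3R_four _) (fun u _ => by simp [η, normalH3R_four])
      (fun u hu X h1 h2 => by
        rw [dy u hu] at h1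
        rw [hdh u (hWU hu)] at h2
        rw [normalH3R_of_four_eq_zero h2] at h1
        exact H.injective u (hWU hu) X h1)
      -- The value of τ is read off from dy(T) = -σn = -σ√(1-σ²) η and dh(T) = 1 - σ².
      (τ := fun t => -s t * (√(1 - s t ^ 2))⁻¹) hV₁ ((hs.mono inter_subset_left).neg.mul hρ) hWV₁
      (μ₂ := fun t => f₁ (-deriv s t) * (√(1 - s t ^ 2))⁻¹)
      (μ₃ := fun t => f₂ (-deriv s t) * (√(1 - s t ^ 2))⁻¹)
      (fun u hu => by
        have h1 := (H.distinct u (hWU hu)).2.2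
        rw [(hrel u (hWU hu)).1, (hrel u (hWU hu)).2, hk u hu] at h1
        rw [← (hfac u hu).2]
        exact fun h => h1 (mul_right_cancel₀ (inv_ne_zero (hsq0 u hu)) h))
      (fun u hu => by
        obtain ⟨-, h1, -, T, e₂, e₃, hT, hT', hNT, he₂, he₃, h2, h3, w₂, w₃⟩ :=
          H.structure_equations (hWU hu)
        have h0 := hsq0 u hu
        have hr := hsq u hu
        refine ⟨T, e₂, e₃, ?_, ?_, ?_, ?_, ?_, ?_, ?_, ?_, ?_⟩
        · rw [hdh u (hWU hu), hT]; exact (hpos u hu).ne'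
        · rw [hdh u (hWU hu), h2]
        · rw [hdh u (hWU hu), h3]
        · rw [dy u hu, hT', hdh u (hWU hu), hT, ← (hfac u hu).2, smul_smul]
          congr 1
          nth_rewrite 2 [← hr]
          field_simp
        · rw [dη u hu, hNT, h1, hT, hdh u (hWU hu), hT, ← (hfac u hu).2, smul_sub, smul_smul, smul_smul]
          rw [show ∀ (P Q R : Fin 5 → ℝ), P - Q + R = (P + R) - Q from fun P Q R => by abel,
            ← add_smul, sub_eq_add_neg, ← neg_smul]
          -- The n-component of dη(T) cancels: the derivative of the normalizing factor, computed
          -- from dσ = -k₁ dh, offsets the contribution of k₁. Hence the normal trajectories are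
          -- geodesics of ℍ³.
          have e1 : (√(1 - N u 4 ^ 2))⁻¹ * (k₁ u * N u 4) +
              N u 4 / √(1 - N u 4 ^ 2) ^ 3 * (-k₁ u * (1 - N u 4 ^ 2)) = 0 := by
            nth_rewrite 3 [← hr]
            field_simp
            ring
          rw [e1, zero_smul, zero_add]
          congr 1
          ring
        · rw [dy u hu, normalH3R_of_four_eq_zero h2]
          exact fun h => he₂ (H.injective u (hWU hu) _ h)
        · rw [dy u hu, normalH3R_of_four_eq_zero h3]
          exact fun h => he₃ (H.injective u (hWU hu) _ h)
        · rw [dy u hu, dη u hu, w₂, normalH3R_smul, normalH3R_of_four_eq_zero h2,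
            (hrel u (hWU hu)).1, hk u hu, (hfac u hu).2]
          simp only [Pi.smul_apply, h2, smul_eq_mul, mul_zero, zero_smul, add_zero, smul_smul]
          congr 1
          ring
        · rw [dy u hu, dη u hu, w₃, normalH3R_smul, normalH3R_of_four_eq_zero h3,
            (hrel u (hWU hu)).2, hk u hu, (hfac u hu).2]
          simp only [Pi.smul_apply, h3, smul_eq_mul, mul_zero, zero_smul, add_zero, smul_smul]
          congr 1
          ring) hpW
  let β : ℝ → ℝ := fun t => b t * (√(1 - s t ^ 2))⁻¹
  have hβ : ContDiffOn ℝ ∞ β (A ∩ V₁) := (hb.mono inter_subset_left).mul (hρ.mono inter_subset_right)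
  have hAV : ∀ u ∈ W', x u 4 ∈ A ∩ V₁ := fun u hu => ⟨(hsplit u hu).1, hWV₁ u (hW'W hu)⟩
  have hx : ∀ u ∈ W', axisProj Φ (x u) =
      a (x u 4) • normalH3R (x u) + β (x u 4) • normalH3R (N u) := by
    intro u hu
    rw [← hΦ.axisProj_normalH3R, (hsplit u hu).2, hηs u (hW'W hu), smul_smul]
  refine ⟨Φ, hΦ, a, β, A, W', hA, ha, ha1, hW', hpW', hW'W.trans hWU, fun u hu => ?_⟩
  have huW := hW'W hu
  have huU := hWU huW
  -- If the coefficient of n vanished, y would be an eigenvector of a projection with eigenvalue a >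
  -- 1.
  refine ⟨(hsplit u hu).1, fun h0 => ?_, hx u hu, fun X k hX hkk => ?_⟩
  · have h1 := hΦ.lorentz_axisProj_self (normalH3R (x u))
    rw [hΦ.axisProj_normalH3R, hx u hu, h0, zero_smul, add_zero] at h1
    simp only [lorentz_smul_left, lorentz_smul_right, lorentz_normalH3R_self (H.mem u huU)] at h1
    nlinarith [ha1 _ (hsplit u hu).1]
  · obtain ⟨hX4, hNX⟩ := (H.structure_equations huU).2.2.1 X k hX hkk
    have d0 := hasFDerivAt_coord (H.differentiableAt huU) 4
    have da := (ha.differentiableAt_of_isOpen hA (hsplit u hu).1).hasDerivAt.comp_hasFDerivAt u d0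
    have db := (hβ.differentiableAt_of_isOpen (hA.inter hV₁) (hAV u hu)).hasDerivAt.comp_hasFDerivAt
      u d0
    have dx := IsLocalHypersurface.hasFDerivAt_normalH3R (H.differentiableAt huU)
    have dN := IsLocalHypersurface.hasFDerivAt_normalH3R (H.differentiableAt_normal huU)
    have hR := (da.smul dx).add (db.smul dN)
    have hL := (LinearMap.toContinuousLinearMap (axisProj Φ)).hasFDerivAt.comp u
      (H.differentiableAt huU).hasFDerivAt
    have hL' := hR.congr_of_eventuallyEq (f₁ := fun u => axisProj Φ (x u))
      (by filter_upwards [hW'.mem_nhds hu] with v hv using hx v hv)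
    have h1 := congrArg (fun L : E →L[ℝ] (Fin 5 → ℝ) => L X) (hL'.unique hL)
    have h2 : normalH3R (fderiv ℝ N u X) = -k • fderiv ℝ x u X := by
      rw [hNX, normalH3R_smul, normalH3R_of_four_eq_zero hX4]
    simp [horizontalL_apply, hX4, h2, normalH3R_of_four_eq_zero hX4] at h1
    rw [← h1]
    module

end LocalSplitting

/-! ### Coordinates on a hypersurface whose distance to the axis depends on the height. -/

section ModelCoordinates

/-- Arclength parametrization of the graph `t ↦ (arsinh √(a t - 1), t)`. -/
theorem exists_profile {a : ℝ → ℝ} {A : Set ℝ} (hA : IsOpen A) (ha : ContDiffOn ℝ ∞ a A)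
    (ha1 : ∀ t ∈ A, 1 < a t) {t₀ : ℝ} (ht₀ : t₀ ∈ A) :
    ∃ (J : Set ℝ) (α₁ α₂ s : ℝ → ℝ) (A' : Set ℝ), IsProfile J α₁ α₂ ∧ IsOpen A' ∧ t₀ ∈ A' ∧ A' ⊆ A ∧
      ContDiffOn ℝ ∞ s A' ∧ ∀ t ∈ A', s t ∈ J ∧ α₂ (s t) = t ∧ Real.cosh (α₁ (s t)) = √(a t) ∧
        Real.sinh (α₁ (s t)) = √(a t - 1) := by
  obtain ⟨ε, hε, hεA⟩ := Metric.isOpen_iff.1 hA t₀ ht₀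
  set B := Metric.ball t₀ ε
  let f : ℝ → ℝ := fun t => Real.arsinh (√(a t - 1))
  have hf : ContDiffOn ℝ ∞ f A :=
    ((ha.sub contDiffOn_const).sqrt fun t ht => (sub_pos.2 (ha1 t ht)).ne').arsinh
  have hf' : ContDiffOn ℝ ∞ (deriv f) A := hf.deriv_of_isOpen hA le_rfl
  have hpos : ∀ t, 0 < 1 + deriv f t ^ 2 := fun t => by positivity
  have hw : ContDiffOn ℝ ∞ (fun t => √(1 + deriv f t ^ 2)) B :=
    ((contDiffOn_const.add (hf'.pow 2)).sqrt fun t _ => (hpos t).ne').mono hεA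
  obtain ⟨S, hS, -, hS'⟩ := exists_smooth_antideriv hε hw
  have ht₀B : t₀ ∈ B := Metric.mem_ball_self hε
  have hwpos : ∀ t, 0 < √(1 + deriv f t ^ 2) := fun t => Real.sqrt_pos.2 (hpos t)
  obtain ⟨e, he, hte, heB, -, -, hes⟩ := exists_openPartialHomeomorph_of_bijective_fderiv
    Metric.isOpen_ball hS ht₀B (by
      have h1 : ∀ v, fderiv ℝ S t₀ v = v * √(1 + deriv f t₀ ^ 2) := fun v => by
        rw [(hS' t₀ ht₀B).hasFDerivAt.fderiv]; simp
      refine ⟨fun v v' h => ?_, fun v => ⟨v / √(1 + deriv f t₀ ^ 2), ?_⟩⟩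
      · rw [h1, h1] at h
        exact mul_right_cancel₀ (hwpos t₀).ne' h
      · rw [h1, div_mul_cancel₀ _ (hwpos t₀).ne'])
  obtain ⟨δ, hδ, hδe⟩ := Metric.isOpen_iff.1 e.open_target _ (e.map_source hte)
  have hder : ∀ s ∈ e.target, HasDerivAt e.symm (√(1 + deriv f (e.symm s) ^ 2))⁻¹ s := fun s hs =>
    e.hasDerivAt_symm hs (hwpos _).ne' (by
      have : (e : ℝ → ℝ) = S := funext he
      rw [this]
      exact hS' _ (heB (e.map_target hs)))
  have hder' : ∀ s ∈ e.target, HasDerivAt (fun s => f (e.symm s))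
      (deriv f (e.symm s) * (√(1 + deriv f (e.symm s) ^ 2))⁻¹) s := fun s hs =>
    (hf.differentiableAt_of_isOpen hA (hεA (heB (e.map_target hs)))).hasDerivAt.comp s (hder s hs)
  have hsinh : ∀ t, Real.sinh (f t) = √(a t - 1) := fun t => Real.sinh_arsinh _
  refine ⟨Metric.ball (e t₀) δ, fun s => f (e.symm s), e.symm, e, e.source ∩ e ⁻¹' Metric.ball (e t₀) δ,
    ⟨Metric.isOpen_ball, (convex_ball _ _).ordConnected, ?_, hes.mono hδe, ?_, ?_⟩,
    e.isOpen_inter_preimage Metric.isOpen_ball, ⟨hte, Metric.mem_ball_self hδ⟩,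
    fun t ht => hεA (heB ht.1), ?_, ?_⟩
  · exact hf.comp (hes.mono hδe) fun s hs => hεA (heB (e.map_target (hδe hs)))
  · intro s hs
    rw [(hder s (hδe hs)).deriv, (hder' s (hδe hs)).deriv]
    have h1 := Real.sq_sqrt (hpos (e.symm s)).le
    have h2 := (hwpos (e.symm s)).ne'
    generalize √(1 + deriv f (e.symm s) ^ 2) = c at h1 h2
    field_simp
    linarith
  · intro s hs
    rw [hsinh]
    exact Real.sqrt_pos.2 (sub_pos.2 (ha1 _ (hεA (heB (e.map_target (hδe hs))))))
  · exact (hS.mono fun t ht => heB ht.1).congr fun t _ => he t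
  · intro t ht
    have h1 := e.left_inv ht.1
    have h2 : 0 < a t - 1 := sub_pos.2 (ha1 t (hεA (heB ht.1)))
    refine ⟨ht.2, h1, ?_, ?_⟩
    · change Real.cosh (f (e.symm (e t))) = _
      rw [h1, Real.cosh_arsinh, Real.sq_sqrt h2.le]
      congr 1; ring
    · change Real.sinh (f (e.symm (e t))) = _
      rw [h1, hsinh]

theorem exists_polar_angle {c s m : ℝ} (hm : 0 < m) (h : c ^ 2 + s ^ 2 = m ^ 2) :
    ∃ θ : ℝ, c = m * Real.cos θ ∧ s = m * Real.sin θ := by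
  have hn : ‖(⟨c, s⟩ : ℂ)‖ = m := by
    rw [Complex.norm_def, Complex.normSq_mk, ← sq, ← sq, h, Real.sqrt_sq hm.le]
  have h0 : (⟨c, s⟩ : ℂ) ≠ 0 := norm_pos_iff.1 (by rw [hn]; exact hm)
  refine ⟨Complex.arg ⟨c, s⟩, ?_, ?_⟩
  · rw [Complex.cos_arg h0, hn]; field_simp
  · rw [Complex.sin_arg, hn]; field_simp

/-- An immersed hypersurface of `ℍ³ × ℝ` on which the distance to the standard geodesic is a
function of the height is locally a model hypersurface. -/
theorem exists_model_coordinates {z : EuclideanSpace ℝ (Fin 3) → Fin 5 → ℝ}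
    {U : Set (EuclideanSpace ℝ (Fin 3))} (hU : IsOpen U) (hz : ContDiffOn ℝ ∞ z U)
    (hinj : ∀ u ∈ U, ∀ X, fderiv ℝ z u X = 0 → X = 0) (hmem : ∀ u ∈ U, z u ∈ H3R)
    {a : ℝ → ℝ} {A : Set ℝ} (hA : IsOpen A) (ha : ContDiffOn ℝ ∞ a A) (ha1 : ∀ t ∈ A, 1 < a t)
    (hza : ∀ u ∈ U, z u 4 ∈ A ∧ -(z u 0) ^ 2 + (z u 1) ^ 2 = -a (z u 4))
    {p : EuclideanSpace ℝ (Fin 3)} (hp : p ∈ U) :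
    ∃ (e : OpenPartialHomeomorph (EuclideanSpace ℝ (Fin 3)) (EuclideanSpace ℝ (Fin 3)))
      (J : Set ℝ) (α₁ α₂ : ℝ → ℝ), IsProfile J α₁ α₂ ∧ p ∈ e.source ∧ e.source ⊆ U ∧
        ContDiffOn ℝ ∞ e e.source ∧ ContDiffOn ℝ ∞ e.symm e.target ∧
        ∀ u ∈ e.source, e u 0 ∈ J ∧ z u = modelHypersurface α₁ α₂ (e u 0) (e u 1) (e u 2) := by
  obtain ⟨J, α₁, α₂, s, A', hprof, hA', hpA', hA'A, hs, hsα⟩ := exists_profile hA ha ha1 (hza p hp).1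
  have hm0 : ∀ u ∈ U, 0 < a (z u 4) - 1 := fun u hu => sub_pos.2 (ha1 _ (hza u hu).1)
  have hsqm : ∀ u ∈ U, z u 2 ^ 2 + z u 3 ^ 2 = √(a (z u 4) - 1) ^ 2 := fun u hu => by
    rw [Real.sq_sqrt (hm0 u hu).le]
    have h1 := (hmem u hu).1
    have h2 := (hza u hu).2
    linarith
  obtain ⟨θ, hθ2, hθ3⟩ := exists_polar_angle (Real.sqrt_pos.2 (hm0 p hp)) (hsqm p hp)
  -- Rotating by the polar angle at p puts (P, Q) on the positive axis there. On P > 0 the angle θ +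
  -- arctan(Q/P) is smooth, with no branch problem.
  let P : EuclideanSpace ℝ (Fin 3) → ℝ := fun u => z u 2 * Real.cos θ + z u 3 * Real.sin θ
  let Q : EuclideanSpace ℝ (Fin 3) → ℝ := fun u => z u 3 * Real.cos θ - z u 2 * Real.sin θ
  have hP : ContDiffOn ℝ ∞ P U := ((hz.coord 2).mul contDiffOn_const).add
    ((hz.coord 3).mul contDiffOn_const)
  have hQ : ContDiffOn ℝ ∞ Q U := ((hz.coord 3).mul contDiffOn_const).sub
    ((hz.coord 2).mul contDiffOn_const)
  let U' := (U ∩ (fun u => z u 4) ⁻¹' A') ∩ (U ∩ P ⁻¹' Ioi 0)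
  have hU' : IsOpen U' := ((hz.coord 4).continuousOn.isOpen_inter_preimage hU hA').inter
    (hP.continuousOn.isOpen_inter_preimage hU isOpen_Ioi)
  have hU'U : U' ⊆ U := fun u hu => hu.1.1
  have hpU' : p ∈ U' := by
    refine ⟨⟨hp, hpA'⟩, hp, ?_⟩
    change 0 < z p 2 * Real.cos θ + z p 3 * Real.sin θ
    rw [hθ2, hθ3]
    have := Real.sin_sq_add_cos_sq θ
    have h1 := Real.sqrt_pos.2 (hm0 p hp)
    nlinarith
  have h4 : ContDiffOn ℝ ∞ (fun u => z u 4) U' := (hz.coord 4).mono hU'U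
  have haz : ContDiffOn ℝ ∞ (fun u => √(a (z u 4))) U' :=
    (ha.comp h4 fun u hu => (hza u (hU'U hu)).1).sqrt fun u hu => by
      change a (z u 4) ≠ 0
      have := hm0 u (hU'U hu)
      linarith
  have ha0 : ∀ u ∈ U', 0 < √(a (z u 4)) := fun u hu => Real.sqrt_pos.2 (by
    have := hm0 u (hU'U hu); linarith)
  let c : EuclideanSpace ℝ (Fin 3) → EuclideanSpace ℝ (Fin 3) := fun u =>
    !₂[s (z u 4), Real.arsinh (z u 1 / √(a (z u 4))), θ + Real.arctan (Q u / P u)]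
  have hc : ContDiffOn ℝ ∞ c U' := by
    rw [contDiffOn_euclidean]
    intro i
    fin_cases i
    · exact hs.comp h4 fun u hu => hu.1.2
    · exact (((hz.coord 1).mono hU'U).div haz fun u hu => (ha0 u hu).ne').arsinh
    · exact contDiffOn_const.add
        ((hQ.mono hU'U).div (hP.mono hU'U) fun u hu => (ne_of_gt hu.2.2)).arctan
  have hmodel : ∀ u ∈ U', c u 0 ∈ J ∧ z u = modelHypersurface α₁ α₂ (c u 0) (c u 1) (c u 2) := by
    intro u hu
    obtain ⟨hJ, h2, hcosh, hsinh⟩ := hsα (z u 4) hu.1.2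
    have huU := hU'U hu
    have c0 : c u 0 = s (z u 4) := rfl
    have c1 : c u 1 = Real.arsinh (z u 1 / √(a (z u 4))) := rfl
    have c2 : c u 2 = θ + Real.arctan (Q u / P u) := rfl
    refine ⟨hJ, ?_⟩
    have ha0u := ha0 u hu
    have hasq : √(a (z u 4)) ^ 2 = a (z u 4) := Real.sq_sqrt (by have := hm0 u huU; linarith)
    have hm := Real.sqrt_pos.2 (hm0 u huU)
    have hPpos : 0 < P u := hu.2.2
    have hPQ : P u ^ 2 + Q u ^ 2 = √(a (z u 4) - 1) ^ 2 := by
      rw [← hsqm u huU]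
      have := Real.sin_sq_add_cos_sq θ
      simp only [P, Q]
      linear_combination (z u 2 ^ 2 + z u 3 ^ 2) * this
    have hroot : √(1 + (Q u / P u) ^ 2) = √(a (z u 4) - 1) / P u := by
      rw [show 1 + (Q u / P u) ^ 2 = (√(a (z u 4) - 1) / P u) ^ 2 by
        rw [div_pow, div_pow, ← hPQ]; field_simp]
      exact Real.sqrt_sq (div_pos hm hPpos).le
    have hcos : √(a (z u 4) - 1) * Real.cos (Real.arctan (Q u / P u)) = P u := by
      rw [Real.cos_arctan, hroot]; field_simp
    have hsin : √(a (z u 4) - 1) * Real.sin (Real.arctan (Q u / P u)) = Q u := by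
      rw [Real.sin_arctan, hroot]; field_simp
    have hcv : √(a (z u 4)) * Real.cosh (Real.arsinh (z u 1 / √(a (z u 4)))) = z u 0 := by
      rw [Real.cosh_arsinh]
      have h0 : 0 < z u 0 := (hmem u huU).2
      have h1 : 1 + (z u 1 / √(a (z u 4))) ^ 2 = (z u 0 / √(a (z u 4))) ^ 2 := by
        have := (hza u huU).2
        rw [div_pow, div_pow, hasq]
        have h3 : a (z u 4) ≠ 0 := by have := hm0 u huU; linarith
        field_simp
        linarith
      rw [h1, Real.sqrt_sq (div_pos h0 ha0u).le]
      field_simp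
    have htrig := Real.sin_sq_add_cos_sq θ
    rw [c0, c1, c2]
    ext i
    fin_cases i
    · simp only [modelHypersurface, hcosh]
      exact hcv.symm
    · simp only [modelHypersurface, hcosh, Real.sinh_arsinh]
      change z u 1 = √(a (z u 4)) * (z u 1 / √(a (z u 4)))
      field_simp
    · simp only [modelHypersurface, hsinh, Real.cos_add]
      change z u 2 = √(a (z u 4) - 1) * (Real.cos θ * Real.cos (Real.arctan (Q u / P u)) -
        Real.sin θ * Real.sin (Real.arctan (Q u / P u)))
      simp only [P, Q] at hcos hsin
      linear_combination (-z u 2) * htrig - Real.cos θ * hcos + Real.sin θ * hsin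
    · simp only [modelHypersurface, hsinh, Real.sin_add]
      change z u 3 = √(a (z u 4) - 1) * (Real.sin θ * Real.cos (Real.arctan (Q u / P u)) +
        Real.cos θ * Real.sin (Real.arctan (Q u / P u)))
      simp only [P, Q] at hcos hsin
      linear_combination (-z u 3) * htrig - Real.sin θ * hcos - Real.cos θ * hsin
    · simp only [modelHypersurface, h2]
      rfl
  have hcp := (hc.differentiableAt_of_isOpen hU' hpU').hasFDerivAt
  have hmd : DifferentiableAt ℝ (fun q : EuclideanSpace ℝ (Fin 3) =>
      modelHypersurface α₁ α₂ (q 0) (q 1) (q 2)) (c p) := by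
    have q0 : ∀ i, DifferentiableAt ℝ (fun q : EuclideanSpace ℝ (Fin 3) => q i) (c p) := fun i =>
      (EuclideanSpace.proj (𝕜 := ℝ) i).differentiableAt
    have hJp := (hmodel p hpU').1
    have d1 : DifferentiableAt ℝ (fun q : EuclideanSpace ℝ (Fin 3) => α₁ (q 0)) (c p) :=
      (hprof.smooth₁.differentiableAt_of_isOpen hprof.isOpen hJp).comp (c p) (q0 0)
    have d2 : DifferentiableAt ℝ (fun q : EuclideanSpace ℝ (Fin 3) => α₂ (q 0)) (c p) :=
      (hprof.smooth₂.differentiableAt_of_isOpen hprof.isOpen hJp).comp (c p) (q0 0)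
    rw [differentiableAt_pi]
    intro i
    fin_cases i
    · exact d1.cosh.mul (q0 1).cosh
    · exact d1.cosh.mul (q0 1).sinh
    · exact d1.sinh.mul (q0 2).cos
    · exact d1.sinh.mul (q0 2).sin
    · exact d2
  -- Near p the immersion z is the model composed with c, so a vector killed by dc is killed by dz.
  have hci : Function.Injective (fderiv ℝ c p) := by
    rw [injective_iff_map_eq_zero]
    intro X hX
    have h1 := (hmd.hasFDerivAt.comp p hcp).congr_of_eventuallyEq (f₁ := z)
      (by filter_upwards [hU'.mem_nhds hpU'] with u hu using (hmodel u hu).2)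
    apply hinj p hp
    rw [h1.fderiv, ContinuousLinearMap.comp_apply, hX, map_zero]
  obtain ⟨e, he, hpe, heU, -, he1, he2⟩ := exists_openPartialHomeomorph_of_bijective_fderiv hU' hc hpU'
    ⟨hci, (LinearMap.injective_iff_surjective (f := (fderiv ℝ c p).toLinearMap)).1 hci⟩
  refine ⟨e, J, α₁, α₂, hprof, hpe, heU.trans hU'U, he1, he2, fun u hu => ?_⟩
  rw [he]
  exact hmodel u (heU hu)

end ModelCoordinates

/-! ### Pointwise uniqueness of the axis projection. -/

section AxisUniqueness

/-- The relation at a point of a parametrized hypersurface that determines the axis projection. -/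
def IsLocalAxis {E : Type*} [NormedAddCommGroup E] [NormedSpace ℝ E] (x N : E → Fin 5 → ℝ)
    (k₁ : E → ℝ) (u : E) (Φ : (Fin 5 → ℝ) ≃ₗ[ℝ] (Fin 5 → ℝ)) : Prop :=
  ∃ a b : ℝ, 1 < a ∧ b ≠ 0 ∧
    axisProj Φ (x u) = a • normalH3R (x u) + b • normalH3R (N u) ∧
    ∀ X k, projH3R (x u) (fderiv ℝ N u X) = -k • fderiv ℝ x u X → k ≠ k₁ u →
      axisProj Φ (fderiv ℝ x u X) = (a - b * k) • fderiv ℝ x u X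

theorem eigenvalue_of_idem {P : (Fin 5 → ℝ) →ₗ[ℝ] (Fin 5 → ℝ)} (hP : ∀ u, P (P u) = P u)
    {v : Fin 5 → ℝ} (hv : v ≠ 0) {c : ℝ} (h : P v = c • v) : c = 0 ∨ c = 1 := by
  have h1 := hP v
  rw [h, map_smul, h, smul_smul] at h1
  have h2 : (c * (c - 1)) • v = 0 := by rw [mul_sub, sub_smul, mul_one, h1, sub_self]
  rcases mul_eq_zero.1 ((smul_eq_zero.1 h2).resolve_right hv) with h3 | h3
  · exact Or.inl h3
  · exact Or.inr (by linarith)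

/-- On the two horizontal principal directions the projection has eigenvalues a - b k₂ and a - b k₃,
which are distinct as b ≠ 0 and so are 0 and 1 in some order. Exchanging the order replaces (a, b)
by (1 - a, -b), which a > 1 forbids. So a and b are determined, and with them the projection on a
basis of ℝ⁵. -/
theorem IsLocalHypersurface.axisProj_unique {E : Type*} [NormedAddCommGroup E] [NormedSpace ℝ E]
    {x N : E → Fin 5 → ℝ} {U : Set E} {k₁ k₂ k₃ : E → ℝ} (H : IsLocalHypersurface x N U k₁ k₂ k₃)
    {u : E} (hu : u ∈ U) {Φ Φ' : (Fin 5 → ℝ) ≃ₗ[ℝ] (Fin 5 → ℝ)} (hΦ : IsVerticalIsometry Φ)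
    (hΦ' : IsVerticalIsometry Φ') (h : IsLocalAxis x N k₁ u Φ) (h' : IsLocalAxis x N k₁ u Φ') :
    axisProj Φ = axisProj Φ' := by
  obtain ⟨a, b, ha, hb, hx, hk⟩ := h
  obtain ⟨a', b', ha', hb', hx', hk'⟩ := h'
  obtain ⟨T, e₂, e₃, σ, -, he₂, he₃, -, -, w₂, w₃⟩ := H.frame u hu
  obtain ⟨hN, -, hhor, -⟩ := H.structure_equations hu
  obtain ⟨d₂, d₃, d⟩ := H.distinct u hu
  obtain ⟨h2, n2⟩ := hhor _ _ w₂ d₂.symm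
  obtain ⟨h3, n3⟩ := hhor _ _ w₃ d₃.symm
  have hv₂ : fderiv ℝ x u e₂ ≠ 0 := fun h => he₂ (H.injective u hu _ h)
  have hv₃ : fderiv ℝ x u e₃ ≠ 0 := fun h => he₃ (H.injective u hu _ h)
  have p₂ := hk _ _ w₂ d₂.symm
  have p₃ := hk _ _ w₃ d₃.symm
  have p₂' := hk' _ _ w₂ d₂.symm
  have p₃' := hk' _ _ w₃ d₃.symm
  have hkk : k₂ u - k₃ u ≠ 0 := sub_ne_zero.2 d
  obtain ⟨rfl, rfl⟩ : a = a' ∧ b = b' := by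
    have c₂ := eigenvalue_of_idem (axisProj_idem Φ) hv₂ p₂
    have c₃ := eigenvalue_of_idem (axisProj_idem Φ) hv₃ p₃
    have c₂' := eigenvalue_of_idem (axisProj_idem Φ') hv₂ p₂'
    have c₃' := eigenvalue_of_idem (axisProj_idem Φ') hv₃ p₃'
    have hne : a - b * k₂ u ≠ a - b * k₃ u := fun h => by
      have : b * (k₂ u - k₃ u) = 0 := by linarith
      exact (mul_ne_zero hb hkk) this
    have hne' : a' - b' * k₂ u ≠ a' - b' * k₃ u := fun h => by
      have : b' * (k₂ u - k₃ u) = 0 := by linarith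
      exact (mul_ne_zero hb' hkk) this
    have hbb : (b - b') * (k₂ u - k₃ u) = 0 ∨ (b + b') * (k₂ u - k₃ u) = 0 := by
      rcases c₂ with c₂ | c₂ <;> rcases c₃ with c₃ | c₃ <;> rcases c₂' with c₂' | c₂' <;>
        rcases c₃' with c₃' | c₃' <;>
        first
          | exact absurd (c₂.trans c₃.symm) hne
          | exact absurd (c₂'.trans c₃'.symm) hne'
          | (left; linarith)
          | (right; linarith)
    rcases hbb with hbb | hbb
    · have hb0 : b = b' := by linarith [(mul_eq_zero.1 hbb).resolve_right hkk]
      subst hb0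
      refine ⟨?_, rfl⟩
      rcases c₂ with c₂ | c₂ <;> rcases c₃ with c₃ | c₃ <;> rcases c₂' with c₂' | c₂' <;>
        rcases c₃' with c₃' | c₃' <;>
        first
          | exact absurd (c₂.trans c₃.symm) hne
          | exact absurd (c₂'.trans c₃'.symm) hne'
          | linarith
    · have hb0 : b' = -b := by linarith [(mul_eq_zero.1 hbb).resolve_right hkk]
      subst hb0
      exfalso
      rcases c₂ with c₂ | c₂ <;> rcases c₃ with c₃ | c₃ <;> rcases c₂' with c₂' | c₂' <;>
        rcases c₃' with c₃' | c₃' <;>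
        first
          | exact absurd (c₂.trans c₃.symm) hne
          | exact absurd (c₂'.trans c₃'.symm) hne'
          | linarith
  have hy : axisProj Φ (normalH3R (x u)) = axisProj Φ' (normalH3R (x u)) := by
    rw [hΦ.axisProj_normalH3R, hΦ'.axisProj_normalH3R, hx, hx']
  -- Applying the projection once more to its value at x and using idempotence solves for its value
  -- at n, since b ≠ 0.
  have hn : axisProj Φ (normalH3R (N u)) = axisProj Φ' (normalH3R (N u)) := by
    have e := axisProj_idem Φ (x u)
    have e' := axisProj_idem Φ' (x u)
    rw [hx, map_add, map_smul, map_smul, hΦ.axisProj_normalH3R, hx] at e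
    rw [hx', map_add, map_smul, map_smul, hΦ'.axisProj_normalH3R, hx'] at e'
    exact smul_right_injective _ hb (add_left_cancel (e.trans e'.symm))
  have hnn : lorentz (normalH3R (N u)) (normalH3R (N u)) = 1 - N u 4 ^ 2 := by
    rw [lorentz_normalH3R_right, lorentz_normalH3R_left, normalH3R_four, H.unit u hu]; ring
  have hyn : lorentz (normalH3R (N u)) (normalH3R (x u)) = 0 := by
    rw [lorentz_normalH3R_left, H.tangent u hu, normalH3R_four]; ring
  have hvn : ∀ X, fderiv ℝ x u X 4 = 0 → lorentz (fderiv ℝ x u X) (normalH3R (N u)) = 0 := by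
    intro X hX
    rw [lorentz_normalH3R_right, lorentz_comm, H.orthogonal u hu, hX]; ring
  refine LinearMap.ext fun v => ?_
  obtain ⟨c₀, c₁, c₂, c₃, c₄, rfl⟩ := exists_coords_of_independent (v₀ := normalH3R (x u))
    (v₁ := normalH3R (N u)) (v₂ := fderiv ℝ x u e₂) (v₃ := fderiv ℝ x u e₃) (v₄ := verticalField)
    (by
      intro c₀ c₁ c₂ c₃ c₄ hc
      have q0 := congrArg (fun v => lorentz v (normalH3R (x u))) hc
      have q1 := congrArg (fun v => lorentz v (normalH3R (N u))) hc
      have q4 := congrArg (fun v => lorentz v verticalField) hc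
      have hvert : ∀ w, lorentz verticalField (normalH3R w) = 0 := fun w => by
        rw [lorentz_comm, lorentz_verticalField, normalH3R_four]
      have hvv : verticalField 4 = 1 := by simp [verticalField]
      simp only [lorentz_add_left, lorentz_smul_left, lorentz_zero_left,
        lorentz_normalH3R_self (H.mem u hu), hyn, hnn, lorentz_comm (normalH3R (x u)) (normalH3R (N u)),
        H.lorentz_fderiv_position hu, hvn _ h2, hvn _ h3, hvert, lorentz_verticalField,
        Pi.add_apply, Pi.smul_apply, Pi.zero_apply, smul_eq_mul, normalH3R_four, h2, h3, hvv]
        at q0 q1 q4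
      have z0 : c₀ = 0 := by linarith
      have z4 : c₄ = 0 := by linarith
      have z1 : c₁ = 0 := by
        have : c₁ * (1 - N u 4 ^ 2) = 0 := by linarith
        exact (mul_eq_zero.1 this).resolve_right (by linarith)
      rw [z0, z1, z4, zero_smul, zero_smul, zero_smul, zero_add, zero_add, add_zero, ← map_smul,
        ← map_smul, ← map_add] at hc
      have hX := H.injective u hu _ hc
      have hX' := congrArg (fderiv ℝ N u) hX
      rw [map_add, map_smul, map_smul, n2, n3, map_zero] at hX'
      rw [map_add, map_smul, map_smul] at hc
      have z2 : ((k₂ u - k₃ u) * c₂) • fderiv ℝ x u e₂ = 0 := by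
        have : ((k₂ u - k₃ u) * c₂) • fderiv ℝ x u e₂ =
            -(k₃ u) • (c₂ • fderiv ℝ x u e₂ + c₃ • fderiv ℝ x u e₃) -
            (c₂ • -k₂ u • fderiv ℝ x u e₂ + c₃ • -k₃ u • fderiv ℝ x u e₃) := by module
        rw [this, hc, hX']; simp
      have z2 : c₂ = 0 :=
        (mul_eq_zero.1 ((smul_eq_zero.1 z2).resolve_right hv₂)).resolve_left hkk
      rw [z2, zero_smul, zero_add] at hc
      exact ⟨z0, z1, z2, (smul_eq_zero.1 hc).resolve_right hv₃, z4⟩) v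
  simp only [map_add, map_smul, hy, hn, p₂, p₂', p₃, p₃', hΦ.axisProj_vertical,
    hΦ'.axisProj_vertical]

end AxisUniqueness

/-! ### Passage between charts and the manifold. -/

section Globalization

variable {M : Type*} [TopologicalSpace M] [ChartedSpace (EuclideanSpace ℝ (Fin 3)) M]

theorem mem_contDiffGroupoid_of_contDiffOn
    {e : OpenPartialHomeomorph (EuclideanSpace ℝ (Fin 3)) (EuclideanSpace ℝ (Fin 3))}
    (he : ContDiffOn ℝ ∞ e e.source) (he' : ContDiffOn ℝ ∞ e.symm e.target) :
    e ∈ contDiffGroupoid ∞ (𝓡 3) := by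
  rw [contDiffGroupoid, mem_groupoid_of_pregroupoid]
  simp [contDiffPregroupoid]
  exact ⟨he, he'⟩

theorem trans_mem_maximalAtlas {G : StructureGroupoid (EuclideanSpace ℝ (Fin 3))}
    {φ : OpenPartialHomeomorph M (EuclideanSpace ℝ (Fin 3))} (hφ : φ ∈ G.maximalAtlas M)
    {e : OpenPartialHomeomorph (EuclideanSpace ℝ (Fin 3)) (EuclideanSpace ℝ (Fin 3))}
    (he : e ∈ G) : φ.trans e ∈ G.maximalAtlas M := by
  refine mem_maximalAtlas_iff.2 fun e' he' => ?_
  obtain ⟨h1, h2⟩ := mem_maximalAtlas_iff.1 hφ e' he'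
  constructor
  · rw [OpenPartialHomeomorph.trans_symm_eq_symm_trans_symm, OpenPartialHomeomorph.trans_assoc]
    exact G.trans (G.symm he) h1
  · rw [← OpenPartialHomeomorph.trans_assoc]
    exact G.trans h2 he

/-- The differential of the inverse of the chart at `p`. -/
noncomputable def chartDifferential (p : M) (u : EuclideanSpace ℝ (Fin 3)) :
    EuclideanSpace ℝ (Fin 3) →L[ℝ]
      TangentSpace (𝓡 3) ((chartAt (EuclideanSpace ℝ (Fin 3)) p).symm u) :=
  mfderiv (𝓡 3) (𝓡 3) (chartAt (EuclideanSpace ℝ (Fin 3)) p).symm u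

theorem chartDifferential_bijective [IsManifold (𝓡 3) ∞ M] (p : M) {u : EuclideanSpace ℝ (Fin 3)}
    (hu : u ∈ (chartAt (EuclideanSpace ℝ (Fin 3)) p).target) :
    Function.Bijective (chartDifferential p u) := by
  have : IsManifold (𝓡 3) 1 M := IsManifold.of_le (n := ∞) (by simp)
  exact (mdifferentiable_chart (I := 𝓡 3) p).symm.mfderiv_bijective hu

theorem contDiffOn_comp_chart_symm [IsManifold (𝓡 3) ∞ M] {y : M → Fin 5 → ℝ}
    (hy : ContMDiff (𝓡 3) 𝓘(ℝ, Fin 5 → ℝ) ∞ y) (p : M) :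
    ContDiffOn ℝ ∞ (fun u => y ((chartAt (EuclideanSpace ℝ (Fin 3)) p).symm u))
      (chartAt (EuclideanSpace ℝ (Fin 3)) p).target :=
  contMDiffOn_iff_contDiffOn.1 (hy.comp_contMDiffOn contMDiffOn_chart_symm)

theorem fderiv_comp_chart_symm [IsManifold (𝓡 3) ∞ M] {y : M → Fin 5 → ℝ}
    (hy : ContMDiff (𝓡 3) 𝓘(ℝ, Fin 5 → ℝ) ∞ y) (p : M) {u : EuclideanSpace ℝ (Fin 3)}
    (hu : u ∈ (chartAt (EuclideanSpace ℝ (Fin 3)) p).target) (X : EuclideanSpace ℝ (Fin 3)) :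
    fderiv ℝ (fun u => y ((chartAt (EuclideanSpace ℝ (Fin 3)) p).symm u)) u X =
      differential y ((chartAt (EuclideanSpace ℝ (Fin 3)) p).symm u) (chartDifferential p u X) := by
  have : IsManifold (𝓡 3) 1 M := IsManifold.of_le (n := ∞) (by simp)
  have h1 := mfderiv_comp (I := 𝓡 3) (I' := 𝓡 3) (I'' := 𝓘(ℝ, Fin 5 → ℝ)) u
    (hy.mdifferentiableAt (by simp) (x := (chartAt (EuclideanSpace ℝ (Fin 3)) p).symm u))
    ((mdifferentiable_chart (I := 𝓡 3) p).symm.mdifferentiableAt hu)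
  have h2 := congrArg (fun L => L X) h1
  rw [mfderiv_eq_fderiv] at h2
  exact h2

variable {x N : M → Fin 5 → ℝ} {S : ∀ q : M, Module.End ℝ (TangentSpace (𝓡 3) q)}

theorem projH3R_chart_iff [IsManifold (𝓡 3) ∞ M] (hx : IsOrientedHypersurface x N)
    (hS : IsShapeOperator x N S) (p : M) {u : EuclideanSpace ℝ (Fin 3)}
    (hu : u ∈ (chartAt (EuclideanSpace ℝ (Fin 3)) p).target) (X : EuclideanSpace ℝ (Fin 3)) (k : ℝ) :
    projH3R (x ((chartAt (EuclideanSpace ℝ (Fin 3)) p).symm u))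
        (fderiv ℝ (fun u => N ((chartAt (EuclideanSpace ℝ (Fin 3)) p).symm u)) u X) =
      -k • fderiv ℝ (fun u => x ((chartAt (EuclideanSpace ℝ (Fin 3)) p).symm u)) u X ↔
    S _ (chartDifferential p u X) = k • chartDifferential p u X := by
  rw [fderiv_comp_chart_symm hx.smooth_immersion p hu, fderiv_comp_chart_symm hx.smooth_normal p hu]
  have h := hS _ (chartDifferential p u X)
  rw [covDerivAlong] at h
  rw [h, neg_smul, neg_inj, ← map_smul]
  exact (hx.injective_differential _).eq_iff

/-- The relation at a point of `M` that determines the axis projection. -/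
def IsAxisAt (x N : M → Fin 5 → ℝ) (S : ∀ q : M, Module.End ℝ (TangentSpace (𝓡 3) q)) (k₁ : M → ℝ)
    (q : M) (Φ : (Fin 5 → ℝ) ≃ₗ[ℝ] (Fin 5 → ℝ)) : Prop :=
  ∃ a b : ℝ, 1 < a ∧ b ≠ 0 ∧
    axisProj Φ (x q) = a • normalH3R (x q) + b • normalH3R (N q) ∧
    ∀ (X : TangentSpace (𝓡 3) q) (k : ℝ), S q X = k • X → k ≠ k₁ q →
      axisProj Φ (differential x q X) = (a - b * k) • differential x q X

/-- The chart-free form lets axes found in different charts be compared at a common point. -/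
theorem isLocalAxis_chart_iff [IsManifold (𝓡 3) ∞ M] (hx : IsOrientedHypersurface x N)
    (hS : IsShapeOperator x N S) (k₁ : M → ℝ) (p : M) {u : EuclideanSpace ℝ (Fin 3)}
    (hu : u ∈ (chartAt (EuclideanSpace ℝ (Fin 3)) p).target)
    (Φ : (Fin 5 → ℝ) ≃ₗ[ℝ] (Fin 5 → ℝ)) :
    IsLocalAxis (fun u => x ((chartAt (EuclideanSpace ℝ (Fin 3)) p).symm u))
      (fun u => N ((chartAt (EuclideanSpace ℝ (Fin 3)) p).symm u))
      (fun u => k₁ ((chartAt (EuclideanSpace ℝ (Fin 3)) p).symm u)) u Φ ↔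
    IsAxisAt x N S k₁ ((chartAt (EuclideanSpace ℝ (Fin 3)) p).symm u) Φ := by
  refine exists_congr fun a => exists_congr fun b => and_congr_right fun _ => and_congr_right fun _ =>
    and_congr_right fun _ => ?_
  rw [(chartDifferential_bijective p hu).2.forall]
  refine forall_congr' fun X => forall_congr' fun k => ?_
  rw [projH3R_chart_iff hx hS p hu, fderiv_comp_chart_symm hx.smooth_immersion p hu]

theorem isLocalHypersurface_chart [IsManifold (𝓡 3) ∞ M] (hx : IsOrientedHypersurface x N)
    (hS : IsShapeOperator x N S) {T : ∀ q : M, TangentSpace (𝓡 3) q}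
    (hT : IsVerticalTangentPart x N T) (hT0 : ∀ q, T q ≠ 0) {k₁ k₂ k₃ : M → ℝ}
    (hk₁ : ∀ q, S q (T q) = k₁ q • T q) (hk₂ : ∀ q, (S q).HasEigenvalue (k₂ q))
    (hk₃ : ∀ q, (S q).HasEigenvalue (k₃ q))
    (hdistinct : ∀ q, k₁ q ≠ k₂ q ∧ k₁ q ≠ k₃ q ∧ k₂ q ≠ k₃ q) (p : M) :
    IsLocalHypersurface (fun u => x ((chartAt (EuclideanSpace ℝ (Fin 3)) p).symm u))
      (fun u => N ((chartAt (EuclideanSpace ℝ (Fin 3)) p).symm u))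
      (chartAt (EuclideanSpace ℝ (Fin 3)) p).target
      (fun u => k₁ ((chartAt (EuclideanSpace ℝ (Fin 3)) p).symm u))
      (fun u => k₂ ((chartAt (EuclideanSpace ℝ (Fin 3)) p).symm u))
      (fun u => k₃ ((chartAt (EuclideanSpace ℝ (Fin 3)) p).symm u)) where
  isOpen := (chartAt (EuclideanSpace ℝ (Fin 3)) p).open_target
  smooth := contDiffOn_comp_chart_symm hx.smooth_immersion p
  smooth_normal := contDiffOn_comp_chart_symm hx.smooth_normal p
  mem u _ := hx.mem _
  injective u hu X h := by
    rw [fderiv_comp_chart_symm hx.smooth_immersion p hu] at h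
    have h1 := hx.injective_differential _ (h.trans (map_zero _).symm)
    exact (chartDifferential_bijective p hu).1 (h1.trans (map_zero _).symm)
  unit u _ := hx.normal_unit _
  tangent u _ := hx.normal_tangent _
  orthogonal u hu X := by
    rw [fderiv_comp_chart_symm hx.smooth_immersion p hu]
    exact hx.normal_orthogonal _ _
  frame u hu := by
    obtain ⟨σ, hσ⟩ := hT
    obtain ⟨v₂, hv₂⟩ := (hk₂ ((chartAt (EuclideanSpace ℝ (Fin 3)) p).symm u)).exists_hasEigenvector
    obtain ⟨v₃, hv₃⟩ := (hk₃ ((chartAt (EuclideanSpace ℝ (Fin 3)) p).symm u)).exists_hasEigenvector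
    have hb := (chartDifferential_bijective p hu).2
    obtain ⟨t, ht⟩ := hb (T _)
    obtain ⟨e₂, he₂⟩ := hb v₂
    obtain ⟨e₃, he₃⟩ := hb v₃
    refine ⟨t, e₂, e₃, σ ((chartAt (EuclideanSpace ℝ (Fin 3)) p).symm u), ?_, ?_, ?_, ?_, ?_, ?_, ?_⟩
    · rintro rfl
      exact hT0 _ (by rw [← ht, map_zero])
    · rintro rfl
      exact hv₂.2 (by rw [← he₂, map_zero])
    · rintro rfl
      exact hv₃.2 (by rw [← he₃, map_zero])
    · rw [fderiv_comp_chart_symm hx.smooth_immersion p hu, ht]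
      exact hσ _
    · rw [projH3R_chart_iff hx hS p hu, ht]
      exact hk₁ _
    · rw [projH3R_chart_iff hx hS p hu, he₂]
      exact hv₂.apply_eq_smul
    · rw [projH3R_chart_iff hx hS p hu, he₃]
      exact hv₃.apply_eq_smul
  distinct u _ := hdistinct _

end Globalization
-- The main theorem.
theorem mainTheorem3 {M : Type*} [TopologicalSpace M]
    [ChartedSpace (EuclideanSpace ℝ (Fin 3)) M] [IsManifold (𝓡 3) ∞ M]
    (x N : M → Fin 5 → ℝ) (hx : IsOrientedHypersurface x N)
    (S : ∀ q : M, Module.End ℝ (TangentSpace (𝓡 3) q)) (hS : IsShapeOperator x N S)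
    (T : ∀ q : M, TangentSpace (𝓡 3) q) (hT : IsVerticalTangentPart x N T)
    (hT0 : ∀ q, T q ≠ 0)
    (k₁ k₂ k₃ : M → ℝ)
    (hk₁ : ∀ q, S q (T q) = k₁ q • T q)
    (hk₂ : ∀ q, (S q).HasEigenvalue (k₂ q))
    (hk₃ : ∀ q, (S q).HasEigenvalue (k₃ q))
    (hdistinct : ∀ q, k₁ q ≠ k₂ q ∧ k₁ q ≠ k₃ q ∧ k₂ q ≠ k₃ q)
    (hrel : ∃ f₁ f₂ : ℝ → ℝ, ∀ q, k₂ q = f₁ (k₁ q) ∧ k₃ q = f₂ (k₁ q)) :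
    ∀ p₀ : M, ∃ Φ : (Fin 5 → ℝ) ≃ₗ[ℝ] (Fin 5 → ℝ), IsLinearIsometryH3R Φ ∧
      ∀ p ∈ connectedComponent p₀, IsOpenPartOfModelNear x Φ p := by
  obtain ⟨f₁, f₂, hf⟩ := hrel
  have hloc := isLocalHypersurface_chart hx hS hT hT0 hk₁ hk₂ hk₃ hdistinct
  have hsplit := fun p : M => (hloc p).exists_splitting (by simp) (fun u _ => hf _)
    (mem_chart_target (EuclideanSpace ℝ (Fin 3)) p)
  choose Φ hΦ a b A W hA ha ha1 hW hpW hWU hsp using hsplit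
  have haxis : ∀ p : M, ∀ u ∈ W p,
      IsAxisAt x N S k₁ ((chartAt (EuclideanSpace ℝ (Fin 3)) p).symm u) (Φ p) := by
    intro p u hu
    obtain ⟨h1, h2, h3, h4⟩ := hsp p u hu
    exact (isLocalAxis_chart_iff hx hS k₁ p (hWU p hu) (Φ p)).1 ⟨_, _, ha1 p _ h1, h2, h3, h4⟩
  -- For q near p, the isometries chosen at p and at q both satisfy the axis relation at q, so their
  -- projections coincide.
  have hconst : IsLocallyConstant fun p => axisProj (Φ p) := by
    rw [IsLocallyConstant.iff_eventually_eq]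
    intro p
    have hev := (chartAt (EuclideanSpace ℝ (Fin 3)) p).continuousAt
      (mem_chart_source (EuclideanSpace ℝ (Fin 3)) p) |>.eventually_mem ((hW p).mem_nhds (hpW p))
    filter_upwards [hev, (chartAt (EuclideanSpace ℝ (Fin 3)) p).open_source.mem_nhds
      (mem_chart_source (EuclideanSpace ℝ (Fin 3)) p)] with q hq hqs
    have h1 := haxis p _ hq
    have h2 := haxis q _ (hpW q)
    rw [OpenPartialHomeomorph.left_inv _ hqs] at h1
    rw [OpenPartialHomeomorph.left_inv _ (mem_chart_source _ q)] at h2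
    have hq' := mem_chart_target (EuclideanSpace ℝ (Fin 3)) q
    have hqq := OpenPartialHomeomorph.left_inv _ (mem_chart_source (EuclideanSpace ℝ (Fin 3)) q)
    exact (hloc q).axisProj_unique hq' (hΦ q) (hΦ p)
      ((isLocalAxis_chart_iff hx hS k₁ q hq' (Φ q)).2 (by rw [hqq]; exact h2))
      ((isLocalAxis_chart_iff hx hS k₁ q hq' (Φ p)).2 (by rw [hqq]; exact h1))
  intro p₀
  refine ⟨Φ p₀, (hΦ p₀).toIsLinearIsometryH3R, fun p hp => ?_⟩
  have hproj : axisProj (Φ p₀) = axisProj (Φ p) :=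
    hconst.apply_eq_of_isPreconnected isPreconnected_connectedComponent mem_connectedComponent hp
  let Ψ : (Fin 5 → ℝ) →L[ℝ] (Fin 5 → ℝ) :=
    LinearMap.toContinuousLinearMap (Φ p₀).symm.toLinearMap
  have hΨ : ∀ v, Ψ v = (Φ p₀).symm v := fun v => rfl
  have hinv : ∀ v, Φ p₀ (Ψ v) = v := fun v => (Φ p₀).apply_symm_apply v
  have hΨ4 : ∀ v, Ψ v 4 = v 4 := fun v => by rw [← (hΦ p₀).apply_four (Ψ v), hinv]
  obtain ⟨e, J, α₁, α₂, hprof, hpe, heW, he, he', hmodel⟩ := exists_model_coordinates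
    (z := fun u => Ψ (x ((chartAt (EuclideanSpace ℝ (Fin 3)) p).symm u))) (hW p)
    (Ψ.contDiff.comp_contDiffOn ((hloc p).smooth.mono (hWU p)))
    (fun u hu X hX => by
      have hd := Ψ.hasFDerivAt.comp u ((hloc p).differentiableAt (hWU p hu)).hasFDerivAt
      have hd' : fderiv ℝ (fun u => Ψ (x ((chartAt (EuclideanSpace ℝ (Fin 3)) p).symm u))) u = _ :=
        hd.fderiv
      rw [hd', ContinuousLinearMap.comp_apply, hΨ, LinearEquiv.map_eq_zero_iff] at hX
      exact (hloc p).injective u (hWU p hu) X hX)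
    (fun u hu => by
      have hmem : x ((chartAt (EuclideanSpace ℝ (Fin 3)) p).symm u) ∈ Φ p₀ '' H3R := by
        rw [(hΦ p₀).toIsLinearIsometryH3R.image_eq]
        exact hx.mem _
      obtain ⟨w, hw, hwx⟩ := hmem
      rw [← hwx, hΨ, LinearEquiv.symm_apply_apply]
      exact hw)
    (hA p) (ha p) (ha1 p)
    (fun u hu => by
      obtain ⟨h1, -, h3, -⟩ := hsp p u hu
      rw [hΨ4]
      refine ⟨h1, ?_⟩
      -- The isometry of p₀ replaces that of p here, as only the common projection matters: ⟨Px, x⟩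
      -- = a⟨y, x⟩ + b⟨n, x⟩ = -a.
      rw [hΨ, ← (hΦ p₀).lorentz_axisProj, hproj, h3, lorentz_add_left, lorentz_smul_left,
        lorentz_smul_left, lorentz_normalH3R_left, lorentz_normalH3R_left]
      have hn := hx.normal_tangent ((chartAt (EuclideanSpace ℝ (Fin 3)) p).symm u)
      rw [lorentz_normalH3R_right] at hn
      have hm := (mem_H3R_iff.1 (hx.mem ((chartAt (EuclideanSpace ℝ (Fin 3)) p).symm u))).1
      rw [← sq, hm, hn]
      ring)
    (hpW p)
  refine ⟨J, α₁, α₂, hprof, (chartAt (EuclideanSpace ℝ (Fin 3)) p).trans e,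
    trans_mem_maximalAtlas (IsManifold.chart_mem_maximalAtlas p)
      (mem_contDiffGroupoid_of_contDiffOn he he'), ?_, fun q hq => ?_⟩
  · rw [OpenPartialHomeomorph.trans_source]
    exact ⟨mem_chart_source _ p, hpe⟩
  · rw [OpenPartialHomeomorph.trans_source] at hq
    obtain ⟨h1, h2⟩ := hmodel _ hq.2
    refine ⟨h1, ?_⟩
    rw [OpenPartialHomeomorph.left_inv _ hq.1] at h2
    rw [← hinv (x q), h2]
    rfl
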